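/- **Theorem 7.4 ($(n+1)$-tuples in $\mathbb R^m$ of type $O(n,1)$).** Let $m>n+1$, $J=\mathrm{diag}(1,\dots,1,-1)=\mathrm{diag}(\epsilon_1,\dots,\epsilon_{n+1})$, $O(n,1)=\{B\in gl(n+1): B^tJB=J\}$, $gl_*(n+1)=\{F\in gl(n+1): f_{ii}=0 \text{ for all } i\}$, and let $C_i\in gl(n+1)$ be the diagonal matrix whose only non-zero entry is $1$ in place $(i,i)$. All maps are smooth. The *$G^1_{m,n}$-system II* for $(F,G,B)$ with values in $gl_*(n+1)\times\mathcal M_{(m-n-1)\times(n+1)}\times O(n,1)$, on an open subset of $\mathbb R^{n+1}$, is $$\begin{cases}(f_{ij})_{x_i}+(f_{ji})_{x_j}+\sum_{k}f_{ki}f_{kj}+\sum_{k}g_{ki}g_{kj}=0,& i\ne j,\\ (f_{ij})_{x_k}=f_{ik}f_{kj},& i,j,k\text{ distinct},\\ (b_{ij})_{x_k}=f_{kj}b_{ik},& j\ne k,\\ (g_{ij})_{x_k}=f_{kj}g_{ik},& j\neq k.\end{cases}$$ *Conventions.* For an immersion $X$ of an open subset of $\mathbb R^{n+1}$ into $\mathbb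 R^m$ with orthonormal normal frame $e_\alpha$, put $I(v,w)=\langle dX(v),dX(w)\rangle$ and $II(v,w)=\sum_\alpha\langle dX(v),de_\alpha(w)\rangle e_\alpha$ (that is, minus the normal part of $D^2X(v,w)$). The normal connection is $\nabla^\perp\xi=(d\xi)^\perp$; the normal bundle is flat if the curvature of $\nabla^\perp$ vanishes, and it is non-degenerate at a point if the space of shape operators $A_\xi$, $\langle A_\xi v,w\rangle=\langle II(v,w),\xi\rangle$, has dimension $n+1$ there. The coordinates $x$ are *hyperbolic line of curvature coordinates* with respect to a parallel orthonormal normal frame $e_{n+2},\dots,e_m$ if $I=\sum_i a_i^2dx_i^2$ and $II=\sum_{i,k}h_{ki}\,dx_i^2\,e_{n+1+k}$ for smooth $a_i,h_{ki}$ with $\sum_i\epsilon_ia_i^2\equiv 1$ or $\sum_i\epsilon_ia_i^2\equiv-1$. An *$(n+1)$-tuple in $\mathbb R^m$ of type $O(n,1)$* on a domain $\mathcal O\subset\mathbb R^{n+1}$ consists of immersions $X_1,\dots,X_{n+1}:\mathcal O\to\mathbb R^m$ with flat normal bundles such that the normal planes of all $X_j$ at each $x\in\mathcal O$ are parallel,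 there is a common parallel orthonormal normal frame $e_{n+2},\dots,e_m$, and $x$ is a hyperbolic line of curvature coordinate system with respect to it for every $X_j$, with $I_j=\sum_i b_{ji}^2dx_i^2$ and $II_j=\sum_{i,k}b_{ji}g_{ki}\,dx_i^2\,e_{n+1+k}$ for some smooth $O(n,1)$-valued $B=(b_{ij})$ and smooth $\mathcal M_{(m-n-1)\times(n+1)}$-valued $G=(g_{ij})$. Suppose that $(F,G,B)$ is a solution on $\mathbb R^{n+1}$ of the $G^1_{m,n}$-system II. Then: (i) $\omega=\sum_{i=1}^{n+1}\begin{pmatrix}-FC_i+C_iF^t& C_iG^t\\-GC_i&0\end{pmatrix}dx_i$ is a flat $o(m)$-valued connection 1-form, and there exists $A:\mathbb R^{n+1}\to O(m)$ with $$A^{-1}dA=\omega.\tag{7.7}$$ (ii) For every such $A=(A_1,A_2)$, with $A_1\in\mathcal M_{m\times(n+1)}$, the form $\sum_iA_1C_iJB^{-1}dx_i$ is exact, and there exists $X:\mathbb R^{n+1}\to\mathcal M_{m\times(n+1)}$ with $$dX=-\sum_{i=1}^{n+1}A_1C_iB^tJ\,dx_i.\tag{7.8}$$ (iii) For all such $A$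 and $X$, let $X_j$ be the $j$-th column of $X$ and $e_i$ the $i$-th column of $A$. If all entries of the $j$-th row of $B$ vanish nowhere, then $X_j$ is an immersion with flat normal bundle, $e_{n+2},\dots,e_m$ is a parallel orthonormal normal frame for $X_j$, $x$ is a hyperbolic line of curvature coordinate system for $X_j$ with respect to it, and $$I_j=\sum_{i=1}^{n+1}b_{ji}^2dx_i^2,\qquad II_j=-\epsilon_j\sum_{i=1}^{n+1}\sum_{k=1}^{m-n-1}g_{ki}b_{ji}\,dx_i^2\,e_{n+1+k};\tag{7.9}$$ moreover the normal bundle of $X_j$ is non-degenerate at $x$ if and only if $\operatorname{rank}G(x)=n+1$. If all entries of $B$ vanish nowhere, then $(X_1,\dots,X_{n+1})$ is an $(n+1)$-tuple in $\mathbb R^m$ of type $O(n,1)$. (iv) Conversely, let $(X_1,\dots,X_{n+1})$ be an $(n+1)$-tuple in $\mathbb R^m$ of type $O(n,1)$ on a domain $\mathcal O\subset\mathbb R^{n+1}$ whose fundamental forms are given by (7.9) with respect to a common parallel orthonormal normal frame $e_{n+2},\dots,e_m$, for some smooth $B=(b_{ij}):\mathcal O\to O(n,1)$ and $G=(g_{ij}):\mathcal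 O\to\mathcal M_{(m-n-1)\times(n+1)}$. Suppose that the normal bundles of all $X_j$ are non-degenerate at every point or, more generally, that no column of $G$ vanishes at any point of $\mathcal O$. Then $(F,G,B)$ is a solution of the $G^1_{m,n}$-system II on $\mathcal O$, where $F=(f_{ij})$, $f_{ij}=(b_{1j})_{x_i}/b_{1i}$ for $i\neq j$ and $f_{ii}=0$. -/

import Mathlib

open scoped ContDiff Matrix RealInnerProductSpace

noncomputable section

/-- Euclidean space `ℝ^k`. -/
abbrev Euc (k : ℕ) : Type := EuclideanSpace ℝ (Fin k)

/-- The partial derivative `f_{x_i}`. -/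
def pderiv {k : ℕ} (i : Fin k) (f : Euc k → ℝ) (x : Euc k) : ℝ :=
  fderiv ℝ f x (EuclideanSpace.single i 1)

/-- The entrywise partial derivative of a matrix-valued map. -/
def matPderiv {k : ℕ} {ι κ : Type*} (i : Fin k) (M : Euc k → Matrix ι κ ℝ) (x : Euc k) :
    Matrix ι κ ℝ :=
  Matrix.of fun a b => pderiv i (fun y => M y a b) x

/-- A matrix-valued map is smooth (C^∞) on `O`. -/
def MatSmoothOn {k : ℕ} {ι κ : Type*} (O : Set (Euc k)) (M : Euc k → Matrix ι κ ℝ) : Prop :=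
  ∀ a b, ContDiffOn ℝ ∞ (fun x => M x a b) O

/-- The `j`-th column of a matrix-valued map, as a map to Euclidean space. -/
def colMap {k m : ℕ} {κ : Type*} (M : Euc k → Matrix (Fin m) κ ℝ) (j : κ) (x : Euc k) : Euc m :=
  WithLp.toLp 2 fun a => M x a j

/-! ### The group `O(n,1)` and the system -/

/-- The signs `ε_1 = ⋯ = ε_n = 1`, `ε_{n+1} = -1`. -/
def lorentzSign (n : ℕ) (i : Fin (n + 1)) : ℝ := if i = Fin.last n then -1 else 1

/-- `J = diag(1, …, 1, -1)`. -/
def lorentzJ (n : ℕ) : Matrix (Fin (n + 1)) (Fin (n + 1)) ℝ := Matrix.diagonal (lorentzSign n)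

/-- `O(n,1)`: the matrices preserving `x_1² + ⋯ + x_n² - x_{n+1}²`. -/
def lorentzO (n : ℕ) : Set (Matrix (Fin (n + 1)) (Fin (n + 1)) ℝ) :=
  {B | Bᵀ * lorentzJ n * B = lorentzJ n}

/-- `(F, G, B)`, with values in `gl_*(n+1) × M_{p × (n+1)} × O(n,1)`, is a smooth solution on `O`
of the `G¹_{m,n}`-system II, where `p = m - n - 1`. -/
structure IsSystemII {n p : ℕ} (O : Set (Euc (n + 1)))
    (F : Euc (n + 1) → Matrix (Fin (n + 1)) (Fin (n + 1)) ℝ)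
    (G : Euc (n + 1) → Matrix (Fin p) (Fin (n + 1)) ℝ)
    (B : Euc (n + 1) → Matrix (Fin (n + 1)) (Fin (n + 1)) ℝ) : Prop where
  smooth_F : MatSmoothOn O F
  smooth_G : MatSmoothOn O G
  smooth_B : MatSmoothOn O B
  diag_F : ∀ x ∈ O, ∀ i, F x i i = 0
  mem_B : ∀ x ∈ O, B x ∈ lorentzO n
  eq_gauss : ∀ x ∈ O, ∀ i j, i ≠ j →
    pderiv i (fun y => F y i j) x + pderiv j (fun y => F y j i) x
      + ∑ k, F x k i * F x k j + ∑ k, G x k i * G x k j = 0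
  eq_F : ∀ x ∈ O, ∀ i j k, i ≠ j → i ≠ k → j ≠ k →
    pderiv k (fun y => F y i j) x = F x i k * F x k j
  eq_B : ∀ x ∈ O, ∀ i j k, j ≠ k → pderiv k (fun y => B y i j) x = F x k j * B x i k
  eq_G : ∀ x ∈ O, ∀ i j k, j ≠ k → pderiv k (fun y => G y i j) x = F x k j * G x i k

/-- `C_i`: the matrix whose only non-zero entry is a `1` in place `(i, i)`. -/
def unitC {n : ℕ} (i : Fin (n + 1)) : Matrix (Fin (n + 1)) (Fin (n + 1)) ℝ := Matrix.single i i 1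

/-- The coefficient of `dx_i` in the matrix-valued 1-form
`∑ i, [[-F C_i + C_i Fᵗ, C_i Gᵗ], [-G C_i, 0]] dx_i`. The rows and columns `1, …, m` are indexed
by `Fin (n+1) ⊕ Fin p`, according to the blocks. -/
def connCoeff {n p : ℕ} (F : Euc (n + 1) → Matrix (Fin (n + 1)) (Fin (n + 1)) ℝ)
    (G : Euc (n + 1) → Matrix (Fin p) (Fin (n + 1)) ℝ) (i : Fin (n + 1)) (x : Euc (n + 1)) :
    Matrix (Fin (n + 1) ⊕ Fin p) (Fin (n + 1) ⊕ Fin p) ℝ :=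
  Matrix.fromBlocks (-(F x * unitC i) + unitC i * (F x)ᵀ) (unitC i * (G x)ᵀ) (-(G x * unitC i)) 0

/-- `∑ i, θ_i dx_i` is a smooth flat `o(m)`-valued connection 1-form on `ℝ^k`. -/
structure IsFlatSkewConnection {k : ℕ} {ι : Type*} [Fintype ι]
    (θ : Fin k → Euc k → Matrix ι ι ℝ) : Prop where
  smooth : ∀ i, MatSmoothOn Set.univ (θ i)
  skew : ∀ i x, (θ i x)ᵀ = -(θ i x)
  flat : ∀ x i j, matPderiv i (θ j) x - matPderiv j (θ i) x + (θ i x * θ j x - θ j x * θ i x) = 0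

/-- `A : ℝ^{n+1} → O(m)` is smooth and `A⁻¹ dA = ∑ i, ω_i dx_i`, i.e. `A_{x_i} = A ω_i`, with
`ω_i = connCoeff F G i`. The columns of `A = (A_1, A_2)` are indexed by blocks: column `inl i` is
`e_i` for `i ≤ n+1`, and column `inr k` is `e_{n+1+k}`. -/
structure IsAdaptedFrame {n p m : ℕ} (F : Euc (n + 1) → Matrix (Fin (n + 1)) (Fin (n + 1)) ℝ)
    (G : Euc (n + 1) → Matrix (Fin p) (Fin (n + 1)) ℝ)
    (A : Euc (n + 1) → Matrix (Fin m) (Fin (n + 1) ⊕ Fin p) ℝ) : Prop where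
  smooth : MatSmoothOn Set.univ A
  orthogonal : ∀ x, (A x)ᵀ * A x = 1 ∧ A x * (A x)ᵀ = 1
  deriv_eq : ∀ x i, matPderiv i A x = A x * connCoeff F G i x

/-! ### Submanifold geometry of a map `X : O → ℝ^m`, `O ⊆ ℝ^d` -/

/-- `X` is a smooth immersion of `O`. -/
def IsImmersionOn {d m : ℕ} (O : Set (Euc d)) (X : Euc d → Euc m) : Prop :=
  ContDiffOn ℝ ∞ X O ∧ ∀ x ∈ O, Function.Injective (fderiv ℝ X x)

/-- The normal plane `ν_x` of `X` at `x`. -/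
def normalSpace {d m : ℕ} (X : Euc d → Euc m) (x : Euc d) : Submodule ℝ (Euc m) :=
  (LinearMap.range (fderiv ℝ X x).toLinearMap)ᗮ

/-- The first fundamental form `I(v, w)`, on coordinate vectors. -/
def firstForm {d m : ℕ} (X : Euc d → Euc m) (x v w : Euc d) : ℝ :=
  ⟪fderiv ℝ X x v, fderiv ℝ X x w⟫

/-- The second fundamental form, with the sign convention `II = ∑_{i,α} ω_{iα} ω_i e_α`,
`ω_{iα} = ⟨e_i, de_α⟩`. In other words `II(v, w) = ∑_α ⟨dX(v), de_α(w)⟩ e_α` for every orthonormal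
normal frame `e_α`; as `⟨dX(v), e_α⟩ = 0`, this is minus the normal part of the second derivative
`D²X(v, w)`. -/
def secondForm {d m : ℕ} (X : Euc d → Euc m) (x v w : Euc d) : Euc m :=
  -((normalSpace X x).starProjection (fderiv ℝ (fun y => fderiv ℝ X y v) x w))

/-- The induced normal connection `∇^⊥_v ξ = (dξ(v))^⊥`. -/
def normalDeriv {d m : ℕ} (X : Euc d → Euc m) (ξ : Euc d → Euc m) (v x : Euc d) : Euc m :=
  (normalSpace X x).starProjection (fderiv ℝ ξ x v)

/-- The normal bundle is flat: the curvature of the induced normal connection vanishes (the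
coordinate vector fields `v`, `w` are constant, so they commute). -/
def HasFlatNormalBundle {d m : ℕ} (O : Set (Euc d)) (X : Euc d → Euc m) : Prop :=
  ∀ ξ : Euc d → Euc m, ContDiffOn ℝ ∞ ξ O → (∀ x ∈ O, ξ x ∈ normalSpace X x) →
    ∀ x ∈ O, ∀ v w : Euc d,
      normalDeriv X (normalDeriv X ξ w) v x = normalDeriv X (normalDeriv X ξ v) w x

/-- The shape operators `A_ξ`, `ξ ∈ ν_x`, read in coordinates: `⟨A_ξ v, w⟩ = ⟨II(v, w), ξ⟩`. -/
def shapeOperators {d m : ℕ} (X : Euc d → Euc m) (x : Euc d) : Set (Euc d →ₗ[ℝ] Euc d) :=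
  {S | ∃ ξ ∈ normalSpace X x, ∀ v w, firstForm X x (S v) w = ⟪secondForm X x v w, ξ⟫}

/-- The normal bundle of the `d`-dimensional `X` is non-degenerate at `x`: the space of shape
operators has dimension `d`. -/
def NondegenerateAt {d m : ℕ} (X : Euc d → Euc m) (x : Euc d) : Prop :=
  Module.finrank ℝ (Submodule.span ℝ (shapeOperators X x)) = d

/-- `e_1, …, e_p` is a smooth orthonormal frame of the normal bundle of `X` over `O`, and it is
parallel for the induced normal connection. -/
structure IsParallelNormalFrame {d m p : ℕ} (O : Set (Euc d)) (X : Euc d → Euc m)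
    (e : Fin p → Euc d → Euc m) : Prop where
  smooth : ∀ k, ContDiffOn ℝ ∞ (e k) O
  orthonormal : ∀ x ∈ O, Orthonormal ℝ fun k => e k x
  span_eq : ∀ x ∈ O, Submodule.span ℝ (Set.range fun k => e k x) = normalSpace X x
  parallel : ∀ x ∈ O, ∀ k v, normalDeriv X (e k) v x = 0

/-- `I = ∑ i, a_i² dx_i²` and `II = ∑ i, ∑ k, h_{ki} dx_i² e_k` on `O`. -/
def HasFundamentalForms {d m p : ℕ} (O : Set (Euc d)) (X : Euc d → Euc m)
    (e : Fin p → Euc d → Euc m) (a : Euc d → Fin d → ℝ) (h : Euc d → Matrix (Fin p) (Fin d) ℝ) :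
    Prop :=
  (∀ x ∈ O, ∀ v w, firstForm X x v w = ∑ i, a x i ^ 2 * (v i * w i)) ∧
  (∀ x ∈ O, ∀ v w, secondForm X x v w = ∑ i, ∑ k, (h x k i * (v i * w i)) • e k x)

/-- The coordinates of `O` are hyperbolic line of curvature coordinates for `X` with respect to the
parallel normal frame `e`: `I = ∑ a_i² dx_i²` and `II = ∑ h_{ki} dx_i² e_k` with smooth `a`, `h`,
and `a_1² + ⋯ + a_n² - a_{n+1}²` is identically `1` or identically `-1`. -/
def IsHyperbolicCurvatureCoords {n m p : ℕ} (O : Set (Euc (n + 1))) (X : Euc (n + 1) → Euc m)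
    (e : Fin p → Euc (n + 1) → Euc m) : Prop :=
  ∃ (a : Euc (n + 1) → Fin (n + 1) → ℝ) (h : Euc (n + 1) → Matrix (Fin p) (Fin (n + 1)) ℝ),
    (∀ i, ContDiffOn ℝ ∞ (fun x => a x i) O) ∧ MatSmoothOn O h ∧
    HasFundamentalForms O X e a h ∧
    ((∀ x ∈ O, ∑ i, lorentzSign n i * a x i ^ 2 = 1) ∨
      (∀ x ∈ O, ∑ i, lorentzSign n i * a x i ^ 2 = -1))

/-- `(X_1, …, X_{n+1})` is an `(n+1)`-tuple in `ℝ^m` of type `O(n,1)` on the domain `O ⊆ ℝ^{n+1}`.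
Non-degeneracy of the normal bundles is a separate property, `NondegenerateAt`. -/
structure IsTuple {n m : ℕ} (O : Set (Euc (n + 1))) (X : Fin (n + 1) → Euc (n + 1) → Euc m) :
    Prop where
  isOpen : IsOpen O
  isConnected : IsConnected O
  immersion : ∀ j, IsImmersionOn O (X j)
  flat : ∀ j, HasFlatNormalBundle O (X j)
  normal_parallel : ∀ x ∈ O, ∀ i j, normalSpace (X i) x = normalSpace (X j) x
  forms : ∃ e : Fin (m - (n + 1)) → Euc (n + 1) → Euc m,
    (∀ j, IsParallelNormalFrame O (X j) e) ∧
    (∀ j, IsHyperbolicCurvatureCoords O (X j) e) ∧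
    ∃ (B : Euc (n + 1) → Matrix (Fin (n + 1)) (Fin (n + 1)) ℝ)
      (G : Euc (n + 1) → Matrix (Fin (m - (n + 1))) (Fin (n + 1)) ℝ),
      MatSmoothOn O B ∧ MatSmoothOn O G ∧ (∀ x ∈ O, B x ∈ lorentzO n) ∧
      ∀ j, HasFundamentalForms O (X j) e (fun x i => B x j i)
        (fun x => Matrix.of fun k i => B x j i * G x k i)

/-- `X_j` has, on `O` and with respect to the normal frame `e`, the fundamental forms
`I_j = ∑ i, b_{ji}² dx_i²` and `II_j = -ε_j ∑ i, ∑ k, g_{ki} b_{ji} dx_i² e_k`. -/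
def HasTupleForms {n m p : ℕ} (O : Set (Euc (n + 1))) (X : Euc (n + 1) → Euc m)
    (e : Fin p → Euc (n + 1) → Euc m) (B : Euc (n + 1) → Matrix (Fin (n + 1)) (Fin (n + 1)) ℝ)
    (G : Euc (n + 1) → Matrix (Fin p) (Fin (n + 1)) ℝ) (j : Fin (n + 1)) : Prop :=
  HasFundamentalForms O X e (fun x i => B x j i)
    (fun x => Matrix.of fun k i => -(lorentzSign n j * (G x k i * B x j i)))

/-- The matrix `F` with `f_{ii} = 0` and `f_{ij} = (b_{1j})_{x_i} / b_{1i}` for `i ≠ j`. -/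
def rotationMatrix {n : ℕ} (B : Euc (n + 1) → Matrix (Fin (n + 1)) (Fin (n + 1)) ℝ)
    (x : Euc (n + 1)) : Matrix (Fin (n + 1)) (Fin (n + 1)) ℝ :=
  Matrix.of fun i j => if i = j then 0 else pderiv i (fun y => B y 0 j) x / B x 0 i

end

/-! The system says that the Gauss, Codazzi and Ricci equations hold for a moving frame whose
tangent vectors are principal for several immersions at once.

From a solution to a tuple. `ω_i` has entries only in row and column `i`. The equations for `F` and
`G` are therefore exactly `dω + ω ∧ ω = 0` (`IsSystemII.isFlatSkewConnection`), the normal block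
vanishing because `C_i C_j = 0`. A flat connection on `ℝ^{n+1}` has a parallel frame: solve the
linear equation along rays from the origin, and use flatness to show that the endpoint depends on
`x` as required (`hasFDerivAt_of_ray_solutions`, `exists_parallel_frame`). Skewness keeps the frame
orthonormal. The frame satisfies `(e_i)_{x_j} = f_{ij} e_j` for `i ≠ j`, and `B` satisfies the
analogous equation, so the `x_i`-derivative of `b_{lj} e_j` is symmetric in `i, j`; the Poincaré
lemma then gives `X`. As `(X_j)_{x_i} = -ε_j b_{ji} e_i`, all `X_j` share their tangent planes and
the normal frame, and the fundamental forms can be read off. Non-degeneracy becomes a rank condition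
because shape operators are diagonal in the coordinates `x`.

From a tuple to a solution. Put `u_i = -(ε_j b_{ji})⁻¹ (X_j)_{x_i}`. The derivative of `e_{n+1+k}`
is tangential, and the second fundamental form identifies it as `g_{ki} u_i dx_i`. The left side
does not depend on `j`, so neither does `u_i` as soon as some `g_{ki} ≠ 0`
(`IsTuple.exists_isPrincipalFrame`). Symmetry of the second derivatives of the `X_j`, combined with
`B ∈ O(n,1)`, gives `(u_i)_{x_l} = f_{il} u_l` for `i ≠ l`; symmetry of the second derivatives of
`u_i` and of the normal frame then yields the system (`IsPrincipalFrame.isSystemII`). -/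

/-! ### Linear differential equations and the Frobenius theorem for linear total systems -/

section LinearODE

variable {ι : Type*} [Fintype ι]

/-- Truncation of the coordinates of a vector to the interval `[-R, R]`. -/
def clampVec (R : ℝ) (y : ι → ℝ) : ι → ℝ := fun i => max (-R) (min R (y i))

lemma lipschitzWith_clampVec (R : ℝ) : LipschitzWith 1 (clampVec R : (ι → ℝ) → ι → ℝ) := by
  refine LipschitzWith.of_dist_le_mul fun x y => ?_
  rw [NNReal.coe_one, one_mul, dist_pi_le_iff dist_nonneg]
  intro i
  have h : LipschitzWith 1 (fun t : ℝ => max (-R) (min R t)) :=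
    (LipschitzWith.id.const_min R).const_max (-R)
  have := h.dist_le_mul (x i) (y i)
  rw [NNReal.coe_one, one_mul] at this
  exact this.trans (dist_le_pi_dist x y i)

lemma norm_clampVec_le {R : ℝ} (hR : 0 ≤ R) (y : ι → ℝ) : ‖clampVec R y‖ ≤ R := by
  rw [pi_norm_le_iff_of_nonneg hR]
  intro i
  rw [Real.norm_eq_abs, abs_le]
  exact ⟨le_max_left _ _, max_le (by linarith) (min_le_left _ _)⟩

lemma norm_clampVec_le_norm {R : ℝ} (hR : 0 ≤ R) (y : ι → ℝ) : ‖clampVec R y‖ ≤ ‖y‖ := by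
  have h0 : clampVec R (0 : ι → ℝ) = 0 := by
    funext i; simp [clampVec, hR]
  simpa [h0] using (lipschitzWith_clampVec R).dist_le_mul y 0

lemma clampVec_eq_self {R : ℝ} {y : ι → ℝ} (hy : ‖y‖ ≤ R) : clampVec R y = y := by
  funext i
  have h := abs_le.1 ((norm_le_pi_norm y i).trans hy)
  simp [clampVec, h.1, h.2]

/-- A linear differential equation with continuous coefficients is solvable on `[0, 1]`. -/
theorem exists_linear_ode_solution (Λ : ℝ → (ι → ℝ) →L[ℝ] (ι → ℝ))
    (hΛ : ContinuousOn Λ (Set.Icc 0 1)) (u₀ : ι → ℝ) :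
    ∃ u : ℝ → ι → ℝ, u 0 = u₀ ∧
      ∀ t ∈ Set.Icc (0 : ℝ) 1, HasDerivWithinAt u (Λ t (u t)) (Set.Icc 0 1) t := by
  obtain ⟨M, hM⟩ := isCompact_Icc.exists_bound_of_continuousOn hΛ
  have hM0 : 0 ≤ M := (norm_nonneg _).trans (hM 0 (by simp))
  -- `R` is the Grönwall bound on `[0, 1]` for solutions of the linear equation. Truncating at `R`
  -- bounds the right-hand side by `M * R`, so Picard–Lindelöf reaches all of `[0, 1]` at once.
  set R : ℝ := ‖u₀‖ * Real.exp M with hRdef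
  have hR : 0 ≤ R := by positivity
  have hpl : IsPicardLindelof (fun t y => Λ t (clampVec R y))
      (⟨0, by simp⟩ : Set.Icc (0 : ℝ) 1) u₀ ⟨M * R, by positivity⟩ 0 ⟨M * R, by positivity⟩
      ⟨M, hM0⟩ := by
    refine ⟨fun t ht => ?_, fun x _ => ?_, fun t ht x _ => ?_, ?_⟩
    · have h : LipschitzWith ⟨M, hM0⟩ (Λ t) := (Λ t).lipschitz.weaken (hM t ht)
      refine LipschitzOnWith.of_dist_le_mul fun a _ b _ => (h.dist_le_mul _ _).trans ?_
      have h' := (lipschitzWith_clampVec R).dist_le_mul a b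
      rw [NNReal.coe_one, one_mul] at h'
      exact mul_le_mul_of_nonneg_left h' hM0
    · exact hΛ.clm_apply continuousOn_const
    · exact ((Λ t).le_of_opNorm_le (hM t ht) _).trans
        (mul_le_mul_of_nonneg_left (norm_clampVec_le hR x) hM0)
    · simp
  obtain ⟨u, hu0, hu⟩ := hpl.exists_eq_forall_mem_Icc_hasDerivWithinAt₀
  refine ⟨u, hu0, fun t ht => ?_⟩
  have hbound : ∀ t ∈ Set.Icc (0 : ℝ) 1, ‖u t‖ ≤ gronwallBound ‖u₀‖ M 0 (t - 0) := by
    refine norm_le_gronwallBound_of_norm_deriv_right_le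
      (f' := fun t => Λ t (clampVec R (u t))) (fun t ht => (hu t ht).continuousWithinAt)
      (fun t ht => ?_) (le_of_eq (by rw [← hu0])) (fun t ht => ?_)
    · exact (hu t (Set.Ico_subset_Icc_self ht)).mono_of_mem_nhdsWithin
        (Icc_mem_nhdsGE_of_mem ht)
    · rw [add_zero]
      exact ((Λ t).le_of_opNorm_le (hM t (Set.Ico_subset_Icc_self ht)) _).trans
        (mul_le_mul_of_nonneg_left (norm_clampVec_le_norm hR _) hM0)
  -- Truncation does not increase the norm, so the Grönwall bound also holds for the truncated
  -- equation. The solution never leaves the region where truncation is the identity.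
  have hut : ‖u t‖ ≤ R := by
    refine (hbound t ht).trans ?_
    rw [gronwallBound_ε0, hRdef]
    have : M * (t - 0) ≤ M := by nlinarith [ht.1, ht.2]
    gcongr
  have := hu t ht
  simp only [clampVec_eq_self hut] at this
  exact this

end LinearODE

/-! ### Total linear systems `dy = Ω y`, solved along rays -/

section Frobenius

variable {V : Type*} [NormedAddCommGroup V] [NormedSpace ℝ V]
  {H : Type*} [NormedAddCommGroup H] [NormedSpace ℝ H]
  {E : Type*} [NormedAddCommGroup E] [NormedSpace ℝ E]

/-- A `C¹` map is differentiable with a first order error which is uniform on bounded sets. -/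
lemma exists_uniform_first_order [FiniteDimensional ℝ V] {Ω : V → H} (hΩ : ContDiff ℝ 1 Ω)
    (R : ℝ) {ε : ℝ} (hε : 0 < ε) :
    ∃ δ > 0, ∀ z w : V, ‖z‖ ≤ R → ‖w‖ < δ → ‖Ω (z + w) - Ω z - fderiv ℝ Ω z w‖ ≤ ε * ‖w‖ := by
  have : ProperSpace V := FiniteDimensional.proper ℝ V
  have hc : Continuous (fderiv ℝ Ω) := hΩ.continuous_fderiv (by norm_num)
  have hu := (isCompact_closedBall (0 : V) (R + 1)).uniformContinuousOn_of_continuous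
    hc.continuousOn
  obtain ⟨δ, hδ, h⟩ := Metric.uniformContinuousOn_iff.1 hu ε hε
  -- The bound `1` keeps the segment from `z` to `z + w` in the ball of radius `R + 1`, where
  -- `fderiv ℝ Ω` is uniformly continuous; the mean value inequality then applies.
  refine ⟨min δ 1, by positivity, fun z w hz hw => ?_⟩
  have hwδ := hw.trans_le (min_le_left _ _)
  have hw1 := hw.trans_le (min_le_right _ _)
  have key := (convex_segment z (z + w)).norm_image_sub_le_of_norm_hasFDerivWithin_le'
    (f := Ω) (f' := fderiv ℝ Ω) (φ := fderiv ℝ Ω z) (C := ε)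
    (fun y _ => ((hΩ.differentiable (by norm_num)) y).hasFDerivAt.hasFDerivWithinAt) ?_
    (left_mem_segment ℝ z (z + w)) (right_mem_segment ℝ z (z + w))
  · simpa using key
  · intro y hy
    have hyz : ‖y - z‖ ≤ ‖w‖ := by
      simpa using norm_sub_le_of_mem_segment hy
    have hy' : ‖y‖ ≤ R + 1 := by
      have := norm_add_le (y - z) z
      rw [sub_add_cancel] at this
      linarith
    rw [← dist_eq_norm]
    refine (h y (by simpa using hy') z (by simp; linarith) ?_).le
    rw [dist_eq_norm]
    linarith

lemma exists_bound_fderiv [FiniteDimensional ℝ V] {Ω : V → H} (hΩ : ContDiff ℝ 1 Ω) (R : ℝ) :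
    ∃ D, 0 ≤ D ∧ ∀ z w : V, z ∈ Metric.closedBall 0 R → ‖fderiv ℝ Ω z w‖ ≤ D * ‖w‖ := by
  have : ProperSpace V := FiniteDimensional.proper ℝ V
  obtain ⟨D, hD⟩ := (isCompact_closedBall (0 : V) R).exists_bound_of_continuousOn
    (f := fderiv ℝ Ω) (hΩ.continuous_fderiv (by norm_num)).continuousOn
  refine ⟨max D 0, le_max_right _ _, fun z w hz => ?_⟩
  exact ContinuousLinearMap.le_of_opNorm_le _ ((hD z hz).trans (le_max_left _ _)) w

lemma hasDerivAt_comp_smul {Ω : V → H} (hΩ : ContDiff ℝ 1 Ω) (x : V) (t : ℝ) :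
    HasDerivAt (fun t : ℝ => Ω (t • x)) (fderiv ℝ Ω (t • x) x) t := by
  have h1 : HasDerivAt (fun t : ℝ => t • x) x t := by
    simpa using (hasDerivAt_id t).smul_const x
  exact ((hΩ.differentiable (by norm_num)) (t • x)).hasFDerivAt.comp_hasDerivAt t h1

/-- Let `U x` solve the equation `u' = Ω (t x) x u` along the ray from `0` to `x`, with initial value
independent of `x`. If `Ω` is flat, then `y x = U x 1` satisfies `dy = Ω y`. -/
theorem hasFDerivAt_of_ray_solutions [FiniteDimensional ℝ V]
    {Ω : V → V →L[ℝ] E →L[ℝ] E} (hΩ : ContDiff ℝ 1 Ω)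
    (hflat : ∀ x v w y, fderiv ℝ Ω x v w y + Ω x w (Ω x v y)
      = fderiv ℝ Ω x w v y + Ω x v (Ω x w y)) {y₀ : E} {U : V → ℝ → E} (hU0 : ∀ x, U x 0 = y₀)
    (hU : ∀ x, ∀ t ∈ Set.Icc (0 : ℝ) 1,
      HasDerivWithinAt (U x) (Ω (t • x) x (U x t)) (Set.Icc 0 1) t) (x : V) :
    HasFDerivAt (fun x => U x 1) ((Ω x).flip (U x 1)) x := by
  have hΩc : Continuous Ω := hΩ.continuous
  have : ProperSpace V := FiniteDimensional.proper ℝ V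
  obtain ⟨C, hC⟩ := isCompact_Icc.exists_bound_of_continuousOn
    (fun t ht => (hU x t ht).continuousWithinAt)
  obtain ⟨M, hM⟩ := (isCompact_closedBall (0 : V) (‖x‖ + 1)).exists_bound_of_continuousOn
    (f := Ω) hΩc.continuousOn
  obtain ⟨D, hD0, hD⟩ := exists_bound_fderiv hΩ (‖x‖ + 1)
  have hC0 : 0 ≤ C := (norm_nonneg _).trans (hC 0 (by simp))
  have hM0 : 0 ≤ M := (norm_nonneg _).trans (hM 0 (by simp; positivity))
  -- `K` bounds the operator `Ω (t • (x + v)) (x + v)` for `‖v‖ ≤ 1`; the extra `1` makes it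
  -- non-zero for the Grönwall formula. `P` collects the constants bounding the error `r`, and `Q`
  -- is `P` times the Grönwall factor at time `1`.
  set K : ℝ := M * (‖x‖ + 1) + 1 with hK
  have hK0 : 0 < K := by positivity
  set P : ℝ := C * (‖x‖ + (1 + D) + ((1 + D) * (‖x‖ + 1) + M) * M) with hP
  set Q : ℝ := P * (1 / K * (Real.exp (K * 1) - 1)) with hQ
  have hexp : 0 ≤ Real.exp (K * 1) - 1 := by
    have := Real.add_one_le_exp (K * 1); linarith
  have hQ0 : 0 ≤ Q := by positivity
  have key : ∀ ε > 0, ε ≤ 1 → ∃ δ > 0, ∀ v : V, ‖v‖ < δ →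
      ‖U (x + v) 1 - U x 1 - Ω x v (U x 1)‖ ≤ Q * (ε + ‖v‖) * ‖v‖ := by
    intro ε hε hε1
    obtain ⟨δ, hδ, h⟩ := exists_uniform_first_order hΩ ‖x‖ hε
    refine ⟨min δ 1, by positivity, fun v hv => ?_⟩
    have hvδ := hv.trans_le (min_le_left _ _)
    have hv1 := hv.trans_le (min_le_right _ _)
    set r : ℝ → E := fun t =>
      (Ω (t • x + t • v) - Ω (t • x) - fderiv ℝ Ω (t • x) (t • v)) x (U x t)
        + (Ω (t • x + t • v) - Ω (t • x)) v (U x t)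
        + ((Ω (t • x + t • v) - Ω (t • x)) (x + v) + Ω (t • x) v) (Ω (t • x) (t • v) (U x t))
      with hr
    -- The expected variation of `U x t` in the direction `v` is `Ω (t • x) (t • v) (U x t)`. By
    -- flatness, the defect of this first order expansion solves the linear equation along the ray
    -- of `x + v` up to the error `r`. The defect vanishes at `t = 0`, so Grönwall makes it `o(v)`
    -- at `t = 1`.
    have hW : ∀ t ∈ Set.Icc (0 : ℝ) 1, HasDerivWithinAt
        (fun t => U (x + v) t - U x t - Ω (t • x) (t • v) (U x t))
        (Ω (t • (x + v)) (x + v) (U (x + v) t - U x t - Ω (t • x) (t • v) (U x t)) + r t)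
        (Set.Icc 0 1) t := by
      intro t ht
      have h2 : HasDerivAt (fun t : ℝ => t • v) v t := by
        simpa using (hasDerivAt_id t).smul_const v
      have h3 : HasDerivAt (fun t : ℝ => Ω (t • x)) (fderiv ℝ Ω (t • x) x) t :=
        hasDerivAt_comp_smul hΩ x t
      have h4 := ((h3.clm_apply h2).hasDerivWithinAt (s := Set.Icc 0 1)).clm_apply (hU x t ht)
      refine (((hU (x + v) t ht).sub (hU x t ht)).sub h4).congr_deriv ?_
      have hf := hflat (t • x) x (t • v) (U x t)
      simp only [hr, smul_add, map_add, map_sub, add_apply,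
        sub_apply] at hf ⊢
      rw [← sub_eq_zero] at hf ⊢
      rw [← neg_eq_zero, ← hf]
      simp only [map_smul, smul_apply]
      module
    have hz : ∀ t ∈ Set.Icc (0 : ℝ) 1, ∀ w : V, ‖t • w‖ ≤ ‖w‖ := by
      intro t ht w
      rw [norm_smul, Real.norm_eq_abs, abs_of_nonneg ht.1]
      exact mul_le_of_le_one_left (norm_nonneg _) ht.2
    have hrb : ∀ t ∈ Set.Icc (0 : ℝ) 1, ‖r t‖ ≤ P * (ε + ‖v‖) * ‖v‖ := by
      intro t ht
      have hx := hz t ht x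
      have hvt := hz t ht v
      have hmem : t • x ∈ Metric.closedBall (0 : V) (‖x‖ + 1) := by simp; linarith
      have hu := hC t ht
      have ha := h (t • x) (t • v) hx (hvt.trans_lt hvδ)
      have hb : ‖Ω (t • x + t • v) - Ω (t • x)‖ ≤ (1 + D) * ‖v‖ := by
        have e := norm_add_le (Ω (t • x + t • v) - Ω (t • x) - fderiv ℝ Ω (t • x) (t • v))
          (fderiv ℝ Ω (t • x) (t • v))
        rw [sub_add_cancel] at e
        have e2 := hD (t • x) (t • v) hmem
        calc _ ≤ _ := e
          _ ≤ ε * ‖t • v‖ + D * ‖t • v‖ := add_le_add ha e2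
          _ = (ε + D) * ‖t • v‖ := by ring
          _ ≤ (1 + D) * ‖v‖ := by gcongr
      have hΩv : ∀ w : V, ‖Ω (t • x) w‖ ≤ M * ‖w‖ :=
        fun w => (Ω (t • x)).le_of_opNorm_le (hM _ hmem) w
      have b1 : ‖(Ω (t • x + t • v) - Ω (t • x) - fderiv ℝ Ω (t • x) (t • v)) x (U x t)‖
          ≤ ε * ‖v‖ * ‖x‖ * C := by
        refine (ContinuousLinearMap.le_of_opNorm_le_of_le _ ?_ hu)
        refine (ContinuousLinearMap.le_of_opNorm_le _ ?_ x)
        exact ha.trans (by gcongr)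
      have b2 : ‖(Ω (t • x + t • v) - Ω (t • x)) v (U x t)‖ ≤ (1 + D) * ‖v‖ * ‖v‖ * C :=
        ContinuousLinearMap.le_of_opNorm_le_of_le _ (ContinuousLinearMap.le_of_opNorm_le _ hb v) hu
      have b3 : ‖((Ω (t • x + t • v) - Ω (t • x)) (x + v) + Ω (t • x) v)
          (Ω (t • x) (t • v) (U x t))‖
          ≤ ((1 + D) * ‖v‖ * (‖x‖ + 1) + M * ‖v‖) * (M * ‖v‖ * C) := by
        refine ContinuousLinearMap.le_of_opNorm_le_of_le _ ((norm_add_le _ _).trans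
          (add_le_add ?_ (hΩv v))) ?_
        · exact ContinuousLinearMap.le_of_opNorm_le_of_le _ hb
            ((norm_add_le _ _).trans (by linarith))
        · exact ContinuousLinearMap.le_of_opNorm_le_of_le _
            ((hΩv _).trans (by gcongr)) hu
      have hsum : ‖r t‖ ≤ ε * ‖v‖ * ‖x‖ * C + (1 + D) * ‖v‖ * ‖v‖ * C
          + ((1 + D) * ‖v‖ * (‖x‖ + 1) + M * ‖v‖) * (M * ‖v‖ * C) :=
        (norm_add₃_le).trans (add_le_add (add_le_add b1 b2) b3)
      refine hsum.trans ?_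
      have : P * (ε + ‖v‖) * ‖v‖ - (ε * ‖v‖ * ‖x‖ * C + (1 + D) * ‖v‖ * ‖v‖ * C
          + ((1 + D) * ‖v‖ * (‖x‖ + 1) + M * ‖v‖) * (M * ‖v‖ * C))
          = C * (‖x‖ * ‖v‖ + ((1 + D) + ((1 + D) * (‖x‖ + 1) + M) * M) * ε) * ‖v‖ := by
        rw [hP]; ring
      have hpos : 0 ≤ C * (‖x‖ * ‖v‖ + ((1 + D) + ((1 + D) * (‖x‖ + 1) + M) * M) * ε) * ‖v‖ := by
        positivity
      linarith
    have hg := norm_le_gronwallBound_of_norm_deriv_right_le (δ := 0) (K := K)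
      (ε := P * (ε + ‖v‖) * ‖v‖) (fun t ht => (hW t ht).continuousWithinAt)
      (fun t ht => (hW t (Set.Ico_subset_Icc_self ht)).mono_of_mem_nhdsWithin
        (Icc_mem_nhdsGE_of_mem ht)) (by simp [hU0]) (fun t ht => ?_) 1 (by simp)
    · simp only [sub_zero, one_smul] at hg
      refine hg.trans (le_of_eq ?_)
      rw [gronwallBound_of_K_ne_0 hK0.ne', hQ]
      ring_nf
    · have ht' := Set.Ico_subset_Icc_self ht
      refine (norm_add_le _ _).trans (add_le_add ?_ (hrb t ht'))
      refine ContinuousLinearMap.le_of_opNorm_le _ ?_ _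
      have hxv : ‖x + v‖ ≤ ‖x‖ + 1 := (norm_add_le _ _).trans (by linarith)
      refine (ContinuousLinearMap.le_of_opNorm_le_of_le _
        (hM _ (by simpa using (hz t ht' _).trans hxv)) hxv).trans ?_
      rw [hK]; linarith
  rw [hasFDerivAt_iff_isLittleO_nhds_zero, Asymptotics.isLittleO_iff]
  intro c hc
  -- With `ε` and `‖v‖` both at most `c / (2 * Q + 1)`, the factor `Q * (ε + ‖v‖)` is at most `c`.
  obtain ⟨δ, hδ, h⟩ := key (min 1 (c / (2 * Q + 1))) (by positivity) (min_le_left _ _)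
  have hε : 0 < min 1 (c / (2 * Q + 1)) := by positivity
  filter_upwards [Metric.ball_mem_nhds (0 : V) (lt_min hδ hε)] with v hv
  rw [mem_ball_zero_iff] at hv
  have hvδ := hv.trans_le (min_le_left _ _)
  have hvε := hv.trans_le (min_le_right _ _)
  refine (h v hvδ).trans ?_
  gcongr
  have h2 : min 1 (c / (2 * Q + 1)) ≤ c / (2 * Q + 1) := min_le_right _ _
  have h3 : c / (2 * Q + 1) * (2 * Q + 1) = c := by field_simp
  have h4 : 0 ≤ c / (2 * Q + 1) := by positivity
  nlinarith

/-- The **Frobenius theorem** for total linear systems: `dy = Ω y` is solvable if `Ω` is flat. -/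
theorem exists_total_linear_solution [FiniteDimensional ℝ V] {ι : Type*} [Fintype ι]
    {Ω : V → V →L[ℝ] (ι → ℝ) →L[ℝ] (ι → ℝ)} (hΩ : ContDiff ℝ 1 Ω)
    (hflat : ∀ x v w y, fderiv ℝ Ω x v w y + Ω x w (Ω x v y)
      = fderiv ℝ Ω x w v y + Ω x v (Ω x w y)) (y₀ : ι → ℝ) :
    ∃ y : V → ι → ℝ, y 0 = y₀ ∧ ∀ x, HasFDerivAt y ((Ω x).flip (y x)) x := by
  have hΩc : Continuous Ω := hΩ.continuous
  have hode : ∀ x : V, ∃ u : ℝ → ι → ℝ, u 0 = y₀ ∧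
      ∀ t ∈ Set.Icc (0 : ℝ) 1, HasDerivWithinAt u (Ω (t • x) x (u t)) (Set.Icc 0 1) t := fun x =>
    exists_linear_ode_solution (fun t => Ω (t • x) x)
      (Continuous.continuousOn (by fun_prop)) y₀
  choose U hU0 hU using hode
  refine ⟨fun x => U x 1, ?_, fun x => hasFDerivAt_of_ray_solutions hΩ hflat hU0 hU x⟩
  -- The ray of `x = 0` is constant, so the equation along it is `u' = 0`.
  refine (constant_of_has_deriv_right_zero (fun t ht => (hU 0 t ht).continuousWithinAt)
    (fun t ht => ?_) 1 (by simp)).trans (hU0 0)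
  have := (hU 0 t (Set.Ico_subset_Icc_self ht)).mono_of_mem_nhdsWithin (Icc_mem_nhdsGE_of_mem ht)
  simpa using this

end Frobenius

/-! ### Partial derivatives -/

section PartialDerivatives

variable {k : ℕ} {E : Type*} [NormedAddCommGroup E] [NormedSpace ℝ E]

/-- The partial derivative of a vector-valued map. -/
noncomputable def vpderiv (i : Fin k) (f : Euc k → E) (x : Euc k) : E :=
  fderiv ℝ f x (EuclideanSpace.single i 1)

lemma pderiv_eq_vpderiv (i : Fin k) (f : Euc k → ℝ) : pderiv i f = vpderiv i f := rfl

lemma euc_eq_sum (v : Euc k) : v = ∑ i, v i • EuclideanSpace.single i (1 : ℝ) := by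
  ext j
  simp [Pi.single_apply]

lemma clm_apply_eq_sum (L : Euc k →L[ℝ] E) (v : Euc k) :
    L v = ∑ i, v i • L (EuclideanSpace.single i 1) := by
  conv_lhs => rw [euc_eq_sum v]
  simp only [map_sum, map_smul]

lemma fderiv_apply_eq_sum (f : Euc k → E) (x v : Euc k) :
    fderiv ℝ f x v = ∑ i, v i • vpderiv i f x :=
  clm_apply_eq_sum _ v

variable {O : Set (Euc k)} {f g : Euc k → E} {x : Euc k} {i j : Fin k}

lemma ContDiffOn.differentiableAt_of_isOpen (hf : ContDiffOn ℝ ∞ f O) (hO : IsOpen O)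
    (hx : x ∈ O) : DifferentiableAt ℝ f x :=
  (hf.contDiffAt (hO.mem_nhds hx)).differentiableAt (by simp)

lemma ContDiffOn.fderiv_apply_const (hf : ContDiffOn ℝ ∞ f O) (hO : IsOpen O) (v : Euc k) :
    ContDiffOn ℝ ∞ (fun y => fderiv ℝ f y v) O :=
  (hf.fderiv_of_isOpen hO (m := ∞) (by simp)).clm_apply contDiffOn_const

lemma ContDiffOn.vpderiv (hf : ContDiffOn ℝ ∞ f O) (hO : IsOpen O) (i : Fin k) :
    ContDiffOn ℝ ∞ (vpderiv i f) O :=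
  hf.fderiv_apply_const hO _

lemma fderiv_fderiv_comm (hf : ContDiffOn ℝ ∞ f O) (hO : IsOpen O) (hx : x ∈ O) (v w : Euc k) :
    fderiv ℝ (fun y => fderiv ℝ f y v) x w = fderiv ℝ (fun y => fderiv ℝ f y w) x v := by
  have hd : DifferentiableAt ℝ (fderiv ℝ f) x :=
    ((hf.fderiv_of_isOpen hO (m := ∞) (by simp)).contDiffAt (hO.mem_nhds hx)).differentiableAt
      (by simp)
  have key : ∀ u u' : Euc k, fderiv ℝ (fun y => fderiv ℝ f y u) x u' =
      fderiv ℝ (fderiv ℝ f) x u' u := by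
    intro u u'
    rw [fderiv_clm_apply hd (differentiableAt_const u)]
    simp
  rw [key, key]
  have hs : IsSymmSndFDerivAt ℝ f x :=
    (hf.contDiffAt (hO.mem_nhds hx)).isSymmSndFDerivAt (by
      rw [minSmoothness_of_isRCLikeNormedField]; exact ENat.LEInfty.out)
  exact hs.eq w v

/-- The integrability conditions in the passage from tuples to solutions come from this symmetry,
applied to the immersions, the principal frame and the normal frame. -/
lemma vpderiv_comm (hf : ContDiffOn ℝ ∞ f O) (hO : IsOpen O) (hx : x ∈ O) (i j : Fin k) :
    vpderiv i (vpderiv j f) x = vpderiv j (vpderiv i f) x :=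
  fderiv_fderiv_comm hf hO hx _ _

lemma vpderiv_congr (hO : IsOpen O) (hx : x ∈ O) (h : ∀ y ∈ O, f y = g y) (i : Fin k) :
    vpderiv i f x = vpderiv i g x := by
  have : f =ᶠ[nhds x] g := Filter.eventually_of_mem (hO.mem_nhds hx) h
  rw [vpderiv, this.fderiv_eq, vpderiv]

lemma vpderiv_const (c : E) : vpderiv i (fun _ => c) x = 0 := by simp [vpderiv]

lemma vpderiv_smul {a : Euc k → ℝ} (ha : DifferentiableAt ℝ a x) (hf : DifferentiableAt ℝ f x)
    (i : Fin k) :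
    vpderiv i (fun y => a y • f y) x = pderiv i a x • f x + a x • vpderiv i f x := by
  simp only [vpderiv, pderiv, fderiv_fun_smul ha hf]
  simp [add_comm]

lemma pderiv_mul {a b : Euc k → ℝ} (ha : DifferentiableAt ℝ a x) (hb : DifferentiableAt ℝ b x)
    (i : Fin k) :
    pderiv i (fun y => a y * b y) x = pderiv i a x * b x + a x * pderiv i b x := by
  exact vpderiv_smul ha hb i

lemma pderiv_const_mul {a : Euc k → ℝ} (c : ℝ) (ha : DifferentiableAt ℝ a x) (i : Fin k) :
    pderiv i (fun y => c * a y) x = c * pderiv i a x := by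
  rw [pderiv_mul (differentiableAt_const c) ha, pderiv_eq_vpderiv, vpderiv_const]
  ring

lemma vpderiv_sum {ι : Type*} {s : Finset ι} {φ : ι → Euc k → E}
    (hφ : ∀ l ∈ s, DifferentiableAt ℝ (φ l) x) (i : Fin k) :
    vpderiv i (fun y => ∑ l ∈ s, φ l y) x = ∑ l ∈ s, vpderiv i (φ l) x := by
  simp only [vpderiv]
  rw [fderiv_fun_sum hφ]
  simp

lemma pderiv_inner {m : ℕ} {f g : Euc k → Euc m} (hf : DifferentiableAt ℝ f x)
    (hg : DifferentiableAt ℝ g x) (i : Fin k) :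
    pderiv i (fun y => ⟪f y, g y⟫) x = ⟪f x, vpderiv i g x⟫ + ⟪vpderiv i f x, g x⟫ := by
  rw [pderiv, fderiv_inner_apply ℝ hf hg]
  rfl

lemma vpderiv_coord {m : ℕ} {f : Euc k → Euc m} (hf : DifferentiableAt ℝ f x) (a : Fin m) :
    (vpderiv i f x) a = pderiv i (fun y => f y a) x := by
  have h : HasFDerivAt (fun y => f y a) ((EuclideanSpace.proj a).comp (fderiv ℝ f x)) x :=
    (EuclideanSpace.proj (𝕜 := ℝ) a).hasFDerivAt.comp x hf.hasFDerivAt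
  rw [pderiv, h.fderiv]
  rfl

lemma contDiffOn_colMap {m : ℕ} {κ : Type*} {M : Euc k → Matrix (Fin m) κ ℝ}
    (hM : MatSmoothOn O M) (j : κ) : ContDiffOn ℝ ∞ (colMap M j) O :=
  contDiffOn_euclidean.2 fun a => hM a j

lemma vpderiv_colMap {m : ℕ} {κ : Type*} {M : Euc k → Matrix (Fin m) κ ℝ}
    (hM : MatSmoothOn O M) (hO : IsOpen O) (hx : x ∈ O) (j : κ) (a : Fin m) :
    vpderiv i (colMap M j) x a = matPderiv i M x a j :=
  vpderiv_coord ((contDiffOn_colMap hM j).differentiableAt_of_isOpen hO hx) a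

/-- A map on a convex open set with prescribed smooth partial derivatives, which satisfy the
integrability condition. -/
lemma exists_of_partial_derivatives [CompleteSpace E] {φ : Fin k → Euc k → E}
    (hφ : ∀ i, ContDiff ℝ ∞ (φ i)) (hsymm : ∀ x i j, vpderiv i (φ j) x = vpderiv j (φ i) x) :
    ∃ f : Euc k → E, ContDiff ℝ ∞ f ∧ ∀ x i, vpderiv i f x = φ i x := by
  -- `ψ = ∑ φ_i dx_i`. The symmetry hypothesis says that its derivative is symmetric, so the
  -- Poincaré lemma on a convex set provides a primitive.
  set ψ : Euc k → Euc k →L[ℝ] E := fun x =>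
    ∑ i, (EuclideanSpace.proj (𝕜 := ℝ) i : Euc k →L[ℝ] ℝ).smulRight (φ i x) with hψ
  have hψs : ContDiff ℝ ∞ ψ := by
    refine ContDiff.sum fun i _ => ?_
    exact contDiff_const.smulRight (hφ i)
  have hψv : ∀ x v, ψ x v = ∑ i, v i • φ i x := by
    intro x v
    simp [hψ]
  have hdψ : ∀ x v w, fderiv ℝ ψ x v w = ∑ i, ∑ j, (w i * v j) • vpderiv j (φ i) x := by
    intro x v w
    have h1 : fderiv ℝ (fun y => ψ y w) x v = fderiv ℝ ψ x v w := by
      rw [fderiv_clm_apply (hψs.differentiable (by simp) x) (differentiableAt_const w)]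
      simp
    rw [← h1]
    simp only [hψv]
    have hd : ∀ i ∈ Finset.univ, DifferentiableAt ℝ (fun y => w i • φ i y) x :=
      fun i _ => ((hφ i).differentiable (by simp) x).const_smul _
    rw [fderiv_fun_sum hd]
    simp only [sum_apply]
    refine Finset.sum_congr rfl fun i _ => ?_
    rw [fderiv_fun_const_smul ((hφ i).differentiable (by simp) x), smul_apply,
      fderiv_apply_eq_sum, Finset.smul_sum]
    simp only [smul_smul]
  obtain ⟨f, hf⟩ := convex_univ.exists_forall_hasFDerivAt_of_fderiv_symmetric isOpen_univ
    (hψs.differentiable (by simp)).differentiableOn (fun x _ v w => by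
      rw [hdψ, hdψ, Finset.sum_comm]
      refine Finset.sum_congr rfl fun i _ => Finset.sum_congr rfl fun j _ => ?_
      rw [hsymm, mul_comm])
  have hf' : fderiv ℝ f = ψ := funext fun x => (hf x (Set.mem_univ x)).fderiv
  refine ⟨f, ?_, fun x i => ?_⟩
  · rw [contDiff_infty_iff_fderiv]
    exact ⟨fun x => (hf x (Set.mem_univ x)).differentiableAt, hf' ▸ hψs⟩
  · rw [vpderiv, hf', hψv]
    simp

end PartialDerivatives

/-! ### Flat connections and adapted frames -/

section FlatConnection

variable {k : ℕ} {ι : Type*} [Fintype ι]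

/-- The coefficient of `c_i^{ab}` in the bilinear map `(v, y) ↦ y (∑ i, v_i c_i)`. -/
noncomputable def vecMulCoeff [DecidableEq ι] (i : Fin k) (a b : ι) :
    Euc k →L[ℝ] (ι → ℝ) →L[ℝ] (ι → ℝ) :=
  (EuclideanSpace.proj (𝕜 := ℝ) i : Euc k →L[ℝ] ℝ).smulRight
    ((ContinuousLinearMap.proj (R := ℝ) (φ := fun _ : ι => ℝ) a).smulRight (Pi.single b (1 : ℝ)))

/-- The bilinear map `(v, y) ↦ y (∑ i, v_i c_i)`. -/
noncomputable def vecMulMap [DecidableEq ι] (c : Fin k → Matrix ι ι ℝ) :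
    Euc k →L[ℝ] (ι → ℝ) →L[ℝ] (ι → ℝ) :=
  ∑ i, ∑ a, ∑ b, c i a b • vecMulCoeff i a b

lemma vecMulMap_apply [DecidableEq ι] (c : Fin k → Matrix ι ι ℝ) (v : Euc k) (y : ι → ℝ) :
    vecMulMap c v y = y ᵥ* ∑ i, v i • c i := by
  ext b
  simp only [vecMulMap, vecMulCoeff, sum_apply, smul_apply, ContinuousLinearMap.smulRight_apply,
    Finset.sum_apply, Pi.smul_apply, Matrix.vecMul, dotProduct, Matrix.sum_apply,
    Matrix.smul_apply, Finset.mul_sum, smul_eq_mul]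
  rw [Finset.sum_comm]
  refine Finset.sum_congr rfl fun a _ => Finset.sum_congr rfl fun i _ => ?_
  simp [Pi.single_apply]
  ring

/-- Keeping the constant vectors `K i a b` arbitrary reduces calculus for `vecMulMap` to that of the
matrix entries. -/
lemma contDiff_sum_smul {H : Type*} [NormedAddCommGroup H] [NormedSpace ℝ H] (K : Fin k → ι → ι → H)
    {θ : Fin k → Euc k → Matrix ι ι ℝ} (hθ : ∀ i, MatSmoothOn Set.univ (θ i)) :
    ContDiff ℝ ∞ fun x => ∑ i, ∑ a, ∑ b, θ i x a b • K i a b :=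
  ContDiff.sum fun i _ => ContDiff.sum fun a _ => ContDiff.sum fun b _ =>
    (contDiffOn_univ.1 (hθ i a b)).smul contDiff_const

lemma fderiv_sum_smul {H : Type*} [NormedAddCommGroup H] [NormedSpace ℝ H] (K : Fin k → ι → ι → H)
    {θ : Fin k → Euc k → Matrix ι ι ℝ} (hθ : ∀ i, MatSmoothOn Set.univ (θ i)) (x v : Euc k) :
    fderiv ℝ (fun x => ∑ i, ∑ a, ∑ b, θ i x a b • K i a b) x v
      = ∑ i, ∑ a, ∑ b, (∑ j, v j • matPderiv j (θ i) x) a b • K i a b := by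
  have hd : ∀ i a b, HasFDerivAt (fun x => θ i x a b • K i a b)
      ((fderiv ℝ (fun x => θ i x a b) x).smulRight (K i a b)) x := fun i a b =>
    (((contDiffOn_univ.1 (hθ i a b)).differentiable (by simp) x).hasFDerivAt).smul_const _
  have h : HasFDerivAt (fun x => ∑ i, ∑ a, ∑ b, θ i x a b • K i a b)
      (∑ i, ∑ a, ∑ b, (fderiv ℝ (fun x => θ i x a b) x).smulRight (K i a b)) x :=
    HasFDerivAt.fun_sum fun i _ => HasFDerivAt.fun_sum fun a _ =>
      HasFDerivAt.fun_sum fun b _ => hd i a b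
  rw [h.fderiv]
  simp only [sum_apply, ContinuousLinearMap.smulRight_apply]
  refine Finset.sum_congr rfl fun i _ => Finset.sum_congr rfl fun a _ =>
    Finset.sum_congr rfl fun b _ => ?_
  rw [fderiv_apply_eq_sum]
  simp only [Matrix.sum_apply, Matrix.smul_apply, matPderiv, Matrix.of_apply]
  rfl

lemma contDiff_vecMulMap [DecidableEq ι] {θ : Fin k → Euc k → Matrix ι ι ℝ}
    (hθ : ∀ i, MatSmoothOn Set.univ (θ i)) :
    ContDiff ℝ ∞ fun x => vecMulMap fun i => θ i x :=
  contDiff_sum_smul vecMulCoeff hθ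

lemma fderiv_vecMulMap [DecidableEq ι] {θ : Fin k → Euc k → Matrix ι ι ℝ}
    (hθ : ∀ i, MatSmoothOn Set.univ (θ i)) (x v : Euc k) :
    fderiv ℝ (fun x => vecMulMap fun i => θ i x) x v
      = vecMulMap fun i => ∑ j, v j • matPderiv j (θ i) x :=
  fderiv_sum_smul vecMulCoeff hθ x v

/-- A flat connection on `ℝ^k` has a parallel frame with any prescribed initial value. -/
theorem exists_parallel_frame {κ : Type*} {θ : Fin k → Euc k → Matrix ι ι ℝ}
    (hθ : IsFlatSkewConnection θ) (A₀ : Matrix κ ι ℝ) :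
    ∃ A : Euc k → Matrix κ ι ℝ, MatSmoothOn Set.univ A ∧ A 0 = A₀ ∧
      ∀ x i, matPderiv i A x = A x * θ i x := by
  classical
  have hs := contDiff_vecMulMap hθ.smooth
  have hflat : ∀ x v w y,
      fderiv ℝ (fun x => vecMulMap fun i => θ i x) x v w y
        + (vecMulMap fun i => θ i x) w ((vecMulMap fun i => θ i x) v y)
      = fderiv ℝ (fun x => vecMulMap fun i => θ i x) x w v y
        + (vecMulMap fun i => θ i x) v ((vecMulMap fun i => θ i x) w y) := by
    intro x v w y
    simp only [fderiv_vecMulMap hθ.smooth, vecMulMap_apply, Matrix.vecMul_vecMul,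
      ← Matrix.vecMul_add]
    -- What remains is `∂_v θ_w + θ_v θ_w = ∂_w θ_v + θ_w θ_v`, bilinear in `v, w`. Composing right
    -- multiplications reverses their order, which matches the sign of the commutator in the
    -- flatness condition.
    congr 1
    have e1 : ∀ v w : Euc k, (∑ i, v i • θ i x) * ∑ i, w i • θ i x
        = ∑ i, ∑ j, (w i * v j) • (θ j x * θ i x) := by
      intro v w
      rw [Finset.sum_mul_sum, Finset.sum_comm]
      refine Finset.sum_congr rfl fun i _ => Finset.sum_congr rfl fun j _ => ?_
      rw [Matrix.smul_mul, Matrix.mul_smul, smul_smul, mul_comm]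
    have e2 : ∀ v w : Euc k, ∑ i, w i • ∑ j, v j • matPderiv j (θ i) x
        = ∑ i, ∑ j, (w i * v j) • matPderiv j (θ i) x := by
      intro v w
      simp only [Finset.smul_sum, smul_smul]
    rw [e1, e2, e1, e2, ← Finset.sum_add_distrib, ← Finset.sum_add_distrib]
    simp only [← Finset.sum_add_distrib, ← smul_add]
    rw [Finset.sum_comm]
    refine Finset.sum_congr rfl fun i _ => Finset.sum_congr rfl fun j _ => ?_
    rw [mul_comm (v i)]
    congr 1
    have := hθ.flat x i j
    rw [← sub_eq_zero]
    rw [← this]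
    abel
  -- The equation `A_{x_i} = A θ_i` acts on each row of `A` separately.
  choose y hy0 hy using fun a => exists_total_linear_solution
    (hs.of_le (by simp)) hflat (A₀ a)
  -- Bootstrapping: the right-hand side of `dy = Ω y` is as regular as `y`, so each step gains one
  -- derivative.
  have hys : ∀ a, ContDiff ℝ ∞ (y a) := by
    intro a
    rw [contDiff_infty]
    intro n
    induction n with
    | zero =>
      exact contDiff_zero.2 (continuous_iff_continuousAt.2 fun x => (hy a x).continuousAt)
    | succ n ih =>
      have hfd : fderiv ℝ (y a) = fun x => (vecMulMap fun i => θ i x).flip (y a x) :=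
        funext fun x => (hy a x).fderiv
      push_cast
      rw [contDiff_succ_iff_fderiv]
      refine ⟨fun x => (hy a x).differentiableAt, by simp, ?_⟩
      rw [hfd]
      rw [contDiff_clm_apply_iff]
      intro v
      exact ((hs.of_le (by exact_mod_cast le_top)).clm_apply contDiff_const).clm_apply ih
  refine ⟨fun x => Matrix.of fun a => y a x, fun a b => ?_, ?_, fun x i => ?_⟩
  · exact (contDiff_pi.1 (hys a) b).contDiffOn
  · ext a b
    simp [hy0]
  · ext a b
    have h : HasFDerivAt (fun x => y a x b) ((ContinuousLinearMap.proj (R := ℝ)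
        (φ := fun _ : ι => ℝ) b).comp ((vecMulMap fun i => θ i x).flip (y a x))) x :=
      (ContinuousLinearMap.proj (R := ℝ) (φ := fun _ : ι => ℝ) b).hasFDerivAt.comp x (hy a x)
    simp only [matPderiv, Matrix.of_apply, pderiv]
    rw [h.fderiv]
    simp [vecMulMap_apply, Matrix.vecMul, dotProduct, Matrix.mul_apply]

end FlatConnection

/-! ### Algebra of `O(n,1)` -/

section Lorentz

variable {n : ℕ}

lemma lorentzSign_mul_self (i : Fin (n + 1)) : lorentzSign n i * lorentzSign n i = 1 := by
  unfold lorentzSign; split_ifs <;> norm_num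

lemma lorentzSign_ne_zero (i : Fin (n + 1)) : lorentzSign n i ≠ 0 := by
  unfold lorentzSign; split_ifs <;> norm_num

lemma lorentzJ_mul_self : lorentzJ n * lorentzJ n = 1 := by
  rw [lorentzJ, Matrix.diagonal_mul_diagonal]
  simp [lorentzSign_mul_self]

lemma lorentz_left_inv {B : Matrix (Fin (n + 1)) (Fin (n + 1)) ℝ} (hB : B ∈ lorentzO n) :
    lorentzJ n * Bᵀ * lorentzJ n * B = 1 := by
  have h : Bᵀ * lorentzJ n * B = lorentzJ n := hB
  rw [Matrix.mul_assoc (lorentzJ n), Matrix.mul_assoc (lorentzJ n), h, lorentzJ_mul_self]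

lemma lorentz_inv {B : Matrix (Fin (n + 1)) (Fin (n + 1)) ℝ} (hB : B ∈ lorentzO n) :
    B⁻¹ = lorentzJ n * Bᵀ * lorentzJ n :=
  Matrix.inv_eq_left_inv (lorentz_left_inv hB)

/-- The transpose of a matrix in `O(n,1)` is in `O(n,1)`. -/
lemma lorentz_mul_transpose {B : Matrix (Fin (n + 1)) (Fin (n + 1)) ℝ} (hB : B ∈ lorentzO n) :
    B * lorentzJ n * Bᵀ = lorentzJ n := by
  have h := mul_eq_one_comm.1 (lorentz_left_inv hB)
  have h2 : B * lorentzJ n * Bᵀ * lorentzJ n * lorentzJ n = lorentzJ n := by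
    have : B * lorentzJ n * Bᵀ * lorentzJ n = 1 := by
      rw [← h]; simp only [Matrix.mul_assoc]
    rw [this, Matrix.one_mul]
  rwa [Matrix.mul_assoc _ (lorentzJ n), lorentzJ_mul_self, Matrix.mul_one] at h2

/-- This is a diagonal entry of `B J Bᵗ = J`. It makes line of curvature coordinates with `a_i =
b_{ji}` hyperbolic, the sign being `ε_j`. -/
lemma lorentz_row_sum {B : Matrix (Fin (n + 1)) (Fin (n + 1)) ℝ} (hB : B ∈ lorentzO n)
    (j : Fin (n + 1)) : ∑ i, lorentzSign n i * B j i ^ 2 = lorentzSign n j := by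
  have h := congrFun (congrFun (lorentz_mul_transpose hB) j) j
  rw [lorentzJ, Matrix.mul_apply, Matrix.diagonal_apply_eq] at h
  simp only [Matrix.mul_diagonal, Matrix.transpose_apply] at h
  rw [← h]
  exact Finset.sum_congr rfl fun i _ => by ring

end Lorentz

/-! ### Flatness of the connection of a solution, and its frames -/

section Connection

variable {n p : ℕ} {F : Euc (n + 1) → Matrix (Fin (n + 1)) (Fin (n + 1)) ℝ}
  {G : Euc (n + 1) → Matrix (Fin p) (Fin (n + 1)) ℝ}
  {B : Euc (n + 1) → Matrix (Fin (n + 1)) (Fin (n + 1)) ℝ}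

/-- `C_i` selects column `i` on the right and row `i` on the left, so only row and column `i`
survive. This sparsity drives the curvature computation. -/
lemma connCoeff_inl_inl (i a b : Fin (n + 1)) (x : Euc (n + 1)) :
    connCoeff F G i x (Sum.inl a) (Sum.inl b)
      = (if a = i then F x b i else 0) - (if b = i then F x a i else 0) := by
  simp only [connCoeff, unitC, Matrix.fromBlocks_apply₁₁, Matrix.add_apply, Matrix.neg_apply,
    Matrix.mul_apply, Matrix.single_apply, Matrix.transpose_apply]
  rw [Finset.sum_eq_single i (by intros; simp_all [eq_comm]) (by simp),
    Finset.sum_eq_single i (by intros; simp_all [eq_comm]) (by simp)]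
  simp only [eq_comm (a := i)]
  split_ifs <;> simp_all

lemma connCoeff_inl_inr (i a : Fin (n + 1)) (k : Fin p) (x : Euc (n + 1)) :
    connCoeff F G i x (Sum.inl a) (Sum.inr k) = if a = i then G x k i else 0 := by
  simp only [connCoeff, unitC, Matrix.fromBlocks_apply₁₂,
    Matrix.mul_apply, Matrix.single_apply, Matrix.transpose_apply]
  rw [Finset.sum_eq_single i (by intros; simp_all [eq_comm]) (by simp)]
  simp only [eq_comm (a := i)]
  split_ifs <;> simp_all

lemma connCoeff_inr_inl (i b : Fin (n + 1)) (k : Fin p) (x : Euc (n + 1)) :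
    connCoeff F G i x (Sum.inr k) (Sum.inl b) = -(if b = i then G x k i else 0) := by
  simp only [connCoeff, unitC, Matrix.fromBlocks_apply₂₁, Matrix.neg_apply,
    Matrix.mul_apply, Matrix.single_apply]
  rw [Finset.sum_eq_single i (by intros; simp_all [eq_comm]) (by simp)]
  simp only [eq_comm (a := i)]
  split_ifs <;> simp_all

lemma connCoeff_inr_inr (i : Fin (n + 1)) (k l : Fin p) (x : Euc (n + 1)) :
    connCoeff F G i x (Sum.inr k) (Sum.inr l) = 0 := rfl

lemma connCoeff_transpose (i : Fin (n + 1)) (x : Euc (n + 1)) :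
    (connCoeff F G i x)ᵀ = -connCoeff F G i x := by
  ext (a | a) (b | b)
  · simp [connCoeff_inl_inl]
  · simp [connCoeff_inl_inr, connCoeff_inr_inl]
  · simp [connCoeff_inl_inr, connCoeff_inr_inl]
  · simp [connCoeff_inr_inr]

lemma matSmoothOn_connCoeff {O : Set (Euc (n + 1))} (hF : MatSmoothOn O F) (hG : MatSmoothOn O G)
    (i : Fin (n + 1)) : MatSmoothOn O (connCoeff F G i) := by
  rintro (a | a) (b | b)
  · simp only [connCoeff_inl_inl]
    refine ContDiffOn.sub ?_ ?_
    · split_ifs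
      exacts [hF _ _, contDiffOn_const]
    · split_ifs
      exacts [hF _ _, contDiffOn_const]
  · simp only [connCoeff_inl_inr]
    split_ifs
    exacts [hG _ _, contDiffOn_const]
  · simp only [connCoeff_inr_inl]
    refine ContDiffOn.neg ?_
    split_ifs
    exacts [hG _ _, contDiffOn_const]
  · exact contDiffOn_const

lemma pderiv_ite (P : Prop) [Decidable P] (f : Euc (n + 1) → ℝ) (i : Fin (n + 1))
    (x : Euc (n + 1)) :
    pderiv i (fun y => if P then f y else 0) x = if P then pderiv i f x else 0 := by
  split_ifs
  · rfl
  · exact vpderiv_const 0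

lemma pderiv_sub {f g : Euc (n + 1) → ℝ} {x : Euc (n + 1)} (hf : DifferentiableAt ℝ f x)
    (hg : DifferentiableAt ℝ g x) (i : Fin (n + 1)) :
    pderiv i (fun y => f y - g y) x = pderiv i f x - pderiv i g x := by
  rw [pderiv, fderiv_fun_sub hf hg]; rfl

lemma pderiv_neg (f : Euc (n + 1) → ℝ) (i : Fin (n + 1)) (x : Euc (n + 1)) :
    pderiv i (fun y => -f y) x = -pderiv i f x := by
  rw [pderiv, fderiv_fun_neg]; rfl

lemma differentiableAt_ite {P : Prop} [Decidable P] {f : Euc (n + 1) → ℝ} {x : Euc (n + 1)}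
    (hf : DifferentiableAt ℝ f x) : DifferentiableAt ℝ (fun y => if P then f y else 0) x := by
  split_ifs
  exacts [hf, differentiableAt_const _]

/-- The connection of a solution of the system is flat. -/
theorem IsSystemII.isFlatSkewConnection (h : IsSystemII Set.univ F G B) :
    IsFlatSkewConnection (connCoeff F G) := by
  refine ⟨matSmoothOn_connCoeff h.smooth_F h.smooth_G, connCoeff_transpose, fun x i j => ?_⟩
  have hF : ∀ a b, DifferentiableAt ℝ (fun y => F y a b) x := fun a b =>
    (h.smooth_F a b).differentiableAt_of_isOpen isOpen_univ (Set.mem_univ x)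
  have hx := Set.mem_univ x
  rcases eq_or_ne i j with rfl | hij
  · simp
  have hd := h.diag_F x hx
  ext (a | k) (b | l)
  · simp only [Matrix.add_apply, Matrix.sub_apply, matPderiv, Matrix.of_apply, Matrix.mul_apply,
      Fintype.sum_sum_type, connCoeff_inl_inl, connCoeff_inl_inr, connCoeff_inr_inl,
      pderiv_sub (differentiableAt_ite (hF _ _)) (differentiableAt_ite (hF _ _)), pderiv_ite,
      Matrix.zero_apply]
    -- `p1` and `p2` are the contributions of tangential and normal intermediate indices to an entry
    -- of `ω_i ω_j`.
    have p1 : ∀ i j : Fin (n + 1), i ≠ j →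
        ∑ c, ((if a = i then F x c i else 0) - (if c = i then F x a i else 0)) *
          ((if c = j then F x b j else 0) - (if b = j then F x c j else 0))
        = (if a = i then F x j i * F x b j else 0) + (if b = j then F x a i * F x i j else 0)
          - (if a = i then if b = j then ∑ c, F x c i * F x c j else 0 else 0) := by
      intro i j hij
      simp only [sub_mul, mul_sub, Finset.sum_sub_distrib, ite_mul, mul_ite, zero_mul, mul_zero,
        Finset.sum_ite_eq', Finset.mem_univ, if_true]
      by_cases ha : a = i <;> by_cases hb : b = j <;> simp [ha, hb, hij.symm]
      ring
    have p2 : ∀ i j : Fin (n + 1),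
        ∑ k, (if a = i then G x k i else 0) * -(if b = j then G x k j else 0)
        = -(if a = i then if b = j then ∑ k, G x k i * G x k j else 0 else 0) := by
      intro i j
      by_cases ha : a = i <;> by_cases hb : b = j <;> simp [ha, hb]
    rw [p1 i j hij, p1 j i hij.symm, p2, p2]
    have hdd : ∀ a c, pderiv c (fun y => F y a a) x = 0 := fun a c => by
      have : (fun y => F y a a) = fun _ => (0 : ℝ) :=
        funext fun y => h.diag_F y (Set.mem_univ y) a
      rw [this]
      exact vpderiv_const 0
    have hg := h.eq_gauss x hx i j hij
    have hs1 : ∑ c, F x c j * F x c i = ∑ c, F x c i * F x c j :=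
      Finset.sum_congr rfl fun c _ => mul_comm _ _
    have hs2 : ∑ c, G x c j * G x c i = ∑ c, G x c i * G x c j :=
      Finset.sum_congr rfl fun c _ => mul_comm _ _
    -- Entries `(i, j)` and `(j, i)` are the Gauss equation. Entries with exactly one index in `{i,
    -- j}` are the equation for `F` with three distinct indices. The others vanish identically,
    -- given that the diagonal of `F` is zero.
    by_cases hai : a = i
    · by_cases hbi : b = i
      · subst hai hbi
        simp [hij, hdd]
        ring
      · by_cases hbj : b = j
        · subst hai hbj
          simp [hij, hij.symm, hd]
          linarith
        · subst hai
          have := h.eq_F x hx b a j hbi hbj hij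
          simp [hij, hbi, hbj, this]
          ring
    · by_cases haj : a = j
      · by_cases hbi : b = i
        · subst haj hbi
          simp [hij, hij.symm, hd, hs1, hs2]
          linarith
        · by_cases hbj : b = j
          · subst haj hbj
            simp [hij.symm, hdd]
            ring
          · subst haj
            have := h.eq_F x hx b a i hbj hbi hij.symm
            simp [hij.symm, hbi, hbj, this]
            ring
      · by_cases hbi : b = i
        · subst hbi
          have := h.eq_F x hx a b j hai haj hij
          simp [hij, hai, haj, this]
        · by_cases hbj : b = j
          · subst hbj
            have := h.eq_F x hx a b i haj hai hij.symm
            simp [hij.symm, hai, haj, this]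
          · simp [hai, haj, hbi, hbj]
  -- The mixed blocks, here and in the next case, are the equation for `G`.
  · simp only [Matrix.add_apply, Matrix.sub_apply, matPderiv, Matrix.of_apply, Matrix.mul_apply,
      Fintype.sum_sum_type, connCoeff_inl_inl, connCoeff_inl_inr, connCoeff_inr_inr,
      pderiv_ite, Matrix.zero_apply]
    by_cases hai : a = i
    · subst hai
      have := h.eq_G x hx l a j hij
      simp [hij, this, hd]
    · by_cases haj : a = j
      · subst haj
        have := h.eq_G x hx l a i hij.symm
        simp [hij.symm, this, hd]
      · simp [hai, haj, hij, hij.symm]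
  · simp only [Matrix.add_apply, Matrix.sub_apply, matPderiv, Matrix.of_apply, Matrix.mul_apply,
      Fintype.sum_sum_type, connCoeff_inl_inl, connCoeff_inr_inl,
      connCoeff_inr_inr, pderiv_ite, pderiv_neg, Matrix.zero_apply]
    by_cases hbi : b = i
    · subst hbi
      have := h.eq_G x hx k b j hij
      simp [hij, hij.symm, this, hd]
      ring
    · by_cases hbj : b = j
      · subst hbj
        have := h.eq_G x hx k b i hij.symm
        simp [hij, hij.symm, this, hd]
        ring
      · simp [hbi, hbj, hij, hij.symm]
  -- The normal block is zero because `G C_i C_j Gᵗ = 0` for `i ≠ j`.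
  · simp only [Matrix.add_apply, Matrix.sub_apply, matPderiv, Matrix.of_apply, Matrix.mul_apply,
      Fintype.sum_sum_type, connCoeff_inl_inr, connCoeff_inr_inl, connCoeff_inr_inr,
      Matrix.zero_apply, pderiv_eq_vpderiv, vpderiv_const]
    simp [hij, hij.symm]

/-- A parallel frame of a skew connection which is orthonormal at a point is orthonormal. -/
lemma parallel_frame_orthonormal {k : ℕ} {ι κ : Type*} [Fintype ι] [DecidableEq κ]
    {θ : Fin k → Euc k → Matrix ι ι ℝ} {A : Euc k → Matrix κ ι ℝ}
    (hθ : ∀ i x, (θ i x)ᵀ = -θ i x) (hA : MatSmoothOn Set.univ A)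
    (hd : ∀ x i, matPderiv i A x = A x * θ i x) (h0 : A 0 * (A 0)ᵀ = 1) (x : Euc k) :
    A x * (A x)ᵀ = 1 := by
  have hdiff : ∀ a c y, DifferentiableAt ℝ (fun y => A y a c) y := fun a c y =>
    (hA a c).differentiableAt_of_isOpen isOpen_univ (Set.mem_univ y)
  ext a b
  -- The derivative of `A Aᵗ` is `A (θ_i + θ_iᵗ) Aᵗ = 0`.
  have hconst : (A x * (A x)ᵀ) a b = (A 0 * (A 0)ᵀ) a b := by
    simp only [Matrix.mul_apply, Matrix.transpose_apply]
    refine is_const_of_fderiv_eq_zero (𝕜 := ℝ) (f := fun y => ∑ c, A y a c * A y b c) ?_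
      (fun y => ?_) x 0
    · exact Differentiable.fun_sum fun c _ y => (hdiff a c y).mul (hdiff b c y)
    · ext v
      rw [fderiv_apply_eq_sum, zero_apply]
      refine Finset.sum_eq_zero fun i _ => ?_
      rw [vpderiv_sum (fun c _ => (hdiff a c y).fun_mul (hdiff b c y))]
      have e : ∀ c, vpderiv i (fun y => A y a c * A y b c) y
          = (A y * θ i y) a c * A y b c + A y a c * (A y * θ i y) b c := by
        intro c
        rw [← hd y i]
        exact pderiv_mul (hdiff a c y) (hdiff b c y) i
      simp only [e]
      have : (A y * θ i y * (A y)ᵀ + A y * (A y * θ i y)ᵀ) a b = 0 := by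
        rw [Matrix.transpose_mul, hθ, Matrix.neg_mul, Matrix.mul_neg, Matrix.mul_assoc,
          add_neg_cancel, Matrix.zero_apply]
      rw [Matrix.add_apply, Matrix.mul_apply, Matrix.mul_apply, ← Finset.sum_add_distrib] at this
      rw [smul_eq_mul]
      exact mul_eq_zero_of_right _ this
  rw [hconst, h0]

/-- A flat connection of the form `connCoeff F G` has an adapted frame. -/
theorem exists_isAdaptedFrame {m : ℕ} (hm : n + 1 + p = m)
    (h : IsFlatSkewConnection (connCoeff F G)) :
    ∃ A : Euc (n + 1) → Matrix (Fin m) (Fin (n + 1) ⊕ Fin p) ℝ, IsAdaptedFrame F G A := by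
  have e : Fin m ≃ Fin (n + 1) ⊕ Fin p := (finCongr hm.symm).trans finSumFinEquiv.symm
  -- The initial value is the identity matrix with its rows relabelled along `e`, since rows and
  -- columns have different index types.
  obtain ⟨A, hs, hA0, hA⟩ := exists_parallel_frame h
    ((1 : Matrix (Fin (n + 1) ⊕ Fin p) (Fin (n + 1) ⊕ Fin p) ℝ).submatrix e id)
  have h0 : A 0 * (A 0)ᵀ = 1 := by
    rw [hA0, Matrix.transpose_submatrix, Matrix.transpose_one]
    ext a b
    simp [Matrix.mul_apply, Matrix.one_apply]
  have horth := parallel_frame_orthonormal h.skew hs hA h0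
  exact ⟨A, hs, fun x => ⟨(Matrix.mul_eq_one_comm_of_equiv e).1 (horth x), horth x⟩, hA⟩

end Connection

/-! ### Structure equations of an adapted frame, and the primitive `X` -/

section AdaptedFrame

variable {n p m : ℕ} {F : Euc (n + 1) → Matrix (Fin (n + 1)) (Fin (n + 1)) ℝ}
  {G : Euc (n + 1) → Matrix (Fin p) (Fin (n + 1)) ℝ}
  {B : Euc (n + 1) → Matrix (Fin (n + 1)) (Fin (n + 1)) ℝ}
  {A : Euc (n + 1) → Matrix (Fin m) (Fin (n + 1) ⊕ Fin p) ℝ}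

/-- For `i ≠ j`, column `i` of `ω_j` has a single non-zero candidate, in row `j`; hence `(e_i)_{x_j}
= f_{ij} e_j`. -/
lemma IsAdaptedFrame.pderiv_inl (hA : IsAdaptedFrame F G A) {i j : Fin (n + 1)} (hij : i ≠ j)
    (x : Euc (n + 1)) (a : Fin m) :
    pderiv j (fun y => A y a (Sum.inl i)) x = F x i j * A x a (Sum.inl j) := by
  have h := congrFun (congrFun (hA.deriv_eq x j) a) (Sum.inl i)
  simp only [matPderiv, Matrix.of_apply, Matrix.mul_apply, Fintype.sum_sum_type,
    connCoeff_inl_inl, connCoeff_inr_inl] at h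
  rw [h]
  simp [hij, mul_comm]

lemma IsAdaptedFrame.pderiv_inr (hA : IsAdaptedFrame F G A) (j : Fin (n + 1)) (k : Fin p)
    (x : Euc (n + 1)) (a : Fin m) :
    pderiv j (fun y => A y a (Sum.inr k)) x = G x k j * A x a (Sum.inl j) := by
  have h := congrFun (congrFun (hA.deriv_eq x j) a) (Sum.inr k)
  simp only [matPderiv, Matrix.of_apply, Matrix.mul_apply, Fintype.sum_sum_type,
    connCoeff_inl_inr, connCoeff_inr_inr] at h
  rw [h]
  simp [mul_comm]

lemma toCols₁_mul_unitC_apply {m p : ℕ} (A : Matrix (Fin m) (Fin (n + 1) ⊕ Fin p) ℝ)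
    (B : Matrix (Fin (n + 1)) (Fin (n + 1)) ℝ) (i l : Fin (n + 1)) (a : Fin m) :
    (A.toCols₁ * unitC i * Bᵀ * lorentzJ n) a l
      = lorentzSign n l * (A a (Sum.inl i) * B l i) := by
  rw [lorentzJ, Matrix.mul_diagonal, Matrix.mul_assoc, Matrix.mul_apply, mul_comm]
  congr 1
  rw [Finset.sum_eq_single i]
  · simp [unitC, Matrix.toCols₁]
  · intro c _ hc
    rw [unitC, Matrix.single_mul_apply_of_ne _ _ _ _ _ hc, mul_zero]
  · simp

/-- The form `A₁ C_i Bᵗ J dx_i` is exact. -/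
theorem IsAdaptedFrame.exists_primitive (hA : IsAdaptedFrame F G A)
    (h : IsSystemII Set.univ F G B) :
    ∃ Y : Euc (n + 1) → Matrix (Fin m) (Fin (n + 1)) ℝ, MatSmoothOn Set.univ Y ∧
      ∀ x i, matPderiv i Y x = (A x).toCols₁ * unitC i * (B x)ᵀ * lorentzJ n := by
  have hAs : ∀ a c, ContDiff ℝ ∞ (fun x => A x a c) := fun a c => contDiffOn_univ.1 (hA.smooth a c)
  have hBs : ∀ a c, ContDiff ℝ ∞ (fun x => B x a c) := fun a c => contDiffOn_univ.1 (h.smooth_B a c)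
  have hAd : ∀ a c x, DifferentiableAt ℝ (fun x => A x a c) x := fun a c x =>
    (hAs a c).differentiable (by simp) x
  have hBd : ∀ a c x, DifferentiableAt ℝ (fun x => B x a c) x := fun a c x =>
    (hBs a c).differentiable (by simp) x
  have hex : ∀ a l, ∃ f : Euc (n + 1) → ℝ, ContDiff ℝ ∞ f ∧ ∀ x i, vpderiv i f x
      = lorentzSign n l * (A x a (Sum.inl i) * B x l i) := by
    intro a l
    refine exists_of_partial_derivatives
      (φ := fun i x => lorentzSign n l * (A x a (Sum.inl i) * B x l i)) (fun i => ?_)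
      (fun x i j => ?_)
    · exact contDiff_const.mul ((hAs _ _).mul (hBs _ _))
    · rcases eq_or_ne i j with rfl | hij
      · rfl
      -- The derivatives of `e_j` and of `b_{lj}` in the direction `x_i` give `f_{ji} b_{lj} e_i +
      -- f_{ij} b_{li} e_j`, which is symmetric in `i` and `j`.
      have e : ∀ i j, i ≠ j →
          vpderiv i (fun x => lorentzSign n l * (A x a (Sum.inl j) * B x l j)) x
          = lorentzSign n l * (F x j i * A x a (Sum.inl i) * B x l j
            + A x a (Sum.inl j) * (F x i j * B x l i)) := by
        intro i j hij
        rw [← pderiv_eq_vpderiv, pderiv_const_mul _ ((hAd _ _ _).fun_mul (hBd _ _ _)),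
          pderiv_mul (hAd _ _ _) (hBd _ _ _), hA.pderiv_inl hij.symm,
          h.eq_B x (Set.mem_univ x) l j i hij.symm]
      rw [e i j hij, e j i hij.symm]
      ring
  choose Y hYs hY using hex
  refine ⟨fun x => Matrix.of fun a l => Y a l x, fun a l => (hYs a l).contDiffOn,
    fun x i => ?_⟩
  ext a l
  rw [toCols₁_mul_unitC_apply, ← hY a l x i]
  rfl

/-- On `O(n,1)` one has `J B⁻¹ = Bᵗ J`, which identifies the form in (ii) with minus the right-hand
side of (7.8). -/
lemma mul_lorentz_inv {B : Matrix (Fin (n + 1)) (Fin (n + 1)) ℝ} (hB : B ∈ lorentzO n)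
    (M : Matrix (Fin m) (Fin (n + 1)) ℝ) : M * lorentzJ n * B⁻¹ = M * Bᵀ * lorentzJ n := by
  rw [lorentz_inv hB]
  simp only [Matrix.mul_assoc]
  rw [← Matrix.mul_assoc (lorentzJ n) (lorentzJ n), lorentzJ_mul_self, Matrix.one_mul]

end AdaptedFrame

/-! ### Submanifolds with a parallel normal frame -/

section NormalFrame

lemma mem_span_orthonormal_eq_sum {ι V : Type*} [Fintype ι] [NormedAddCommGroup V]
    [InnerProductSpace ℝ V] {u : ι → V} (hu : Orthonormal ℝ u) {w : V}
    (hw : w ∈ Submodule.span ℝ (Set.range u)) : w = ∑ k, ⟪u k, w⟫ • u k := by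
  obtain ⟨c, rfl⟩ := (Submodule.mem_span_range_iff_exists_fun ℝ).1 hw
  refine Finset.sum_congr rfl fun k _ => ?_
  rw [hu.inner_right_fintype]

lemma starProjection_eq_sum {ι V : Type*} [Fintype ι] [NormedAddCommGroup V]
    [InnerProductSpace ℝ V] {K : Submodule ℝ V} [K.HasOrthogonalProjection] {u : ι → V}
    (hu : Orthonormal ℝ u) (hK : Submodule.span ℝ (Set.range u) = K) (w : V) :
    K.starProjection w = ∑ k, ⟪u k, w⟫ • u k := by
  have hmem : ∀ k, u k ∈ K := fun k => hK ▸ Submodule.subset_span (Set.mem_range_self k)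
  rw [mem_span_orthonormal_eq_sum hu
    (show K.starProjection w ∈ _ from hK ▸ K.starProjection_apply_mem w)]
  refine Finset.sum_congr rfl fun k _ => ?_
  rw [← Submodule.inner_starProjection_left_eq_right,
    Submodule.starProjection_eq_self_iff.2 (hmem k)]

variable {d m p : ℕ} {O : Set (Euc d)} {X : Euc d → Euc m} {e : Fin p → Euc d → Euc m}
  {x : Euc d}

lemma mem_normalSpace_iff (w : Euc m) : w ∈ normalSpace X x ↔ ∀ v, ⟪fderiv ℝ X x v, w⟫ = 0 := by
  rw [normalSpace, Submodule.mem_orthogonal]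
  simp

lemma mem_normalSpace_iff_vpderiv (w : Euc m) :
    w ∈ normalSpace X x ↔ ∀ i, ⟪vpderiv i X x, w⟫ = 0 := by
  rw [mem_normalSpace_iff]
  refine ⟨fun h i => h _, fun h v => ?_⟩
  rw [fderiv_apply_eq_sum, sum_inner]
  exact Finset.sum_eq_zero fun i _ => by rw [inner_smul_left, h i, mul_zero]

namespace IsParallelNormalFrame

lemma mem_normalSpace (he : IsParallelNormalFrame O X e) (hx : x ∈ O) (k : Fin p) :
    e k x ∈ normalSpace X x :=
  he.span_eq x hx ▸ Submodule.subset_span (Set.mem_range_self k)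

lemma differentiableAt (he : IsParallelNormalFrame O X e) (hO : IsOpen O) (hx : x ∈ O)
    (k : Fin p) : DifferentiableAt ℝ (e k) x :=
  (he.smooth k).differentiableAt_of_isOpen hO hx

/-- Being parallel means that `de_k` is tangential: the normal projection is self-adjoint, fixes `w`
and kills `de_k(v)`. -/
lemma inner_fderiv_eq_zero (he : IsParallelNormalFrame O X e) (hx : x ∈ O) (k : Fin p)
    (v : Euc d) {w : Euc m} (hw : w ∈ normalSpace X x) : ⟪fderiv ℝ (e k) x v, w⟫ = 0 := by
  have h := he.parallel x hx k v
  rw [normalDeriv] at h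
  rw [← Submodule.starProjection_eq_self_iff.2 hw,
    ← Submodule.inner_starProjection_left_eq_right, h, inner_zero_left]

/-- In a parallel frame the normal connection is ordinary differentiation of coefficients; its
flatness is then the symmetry of second derivatives. -/
lemma normalDeriv_eq_sum (he : IsParallelNormalFrame O X e) (hO : IsOpen O)
    {ξ : Euc d → Euc m} (hξ : ContDiffOn ℝ ∞ ξ O) (hn : ∀ x ∈ O, ξ x ∈ normalSpace X x)
    (hx : x ∈ O) (v : Euc d) :
    normalDeriv X ξ v x = ∑ k, (fderiv ℝ (fun y => ⟪e k y, ξ y⟫) x v) • e k x := by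
  rw [normalDeriv, starProjection_eq_sum (he.orthonormal x hx) (he.span_eq x hx)]
  refine Finset.sum_congr rfl fun k _ => ?_
  rw [fderiv_inner_apply ℝ (he.differentiableAt hO hx k) (hξ.differentiableAt_of_isOpen hO hx),
    he.inner_fderiv_eq_zero hx k v (hn x hx), add_zero]

/-- The normal bundle is flat if there is a parallel normal frame. -/
theorem hasFlatNormalBundle (he : IsParallelNormalFrame O X e) (hO : IsOpen O) :
    HasFlatNormalBundle O X := by
  intro ξ hξ hn x hx v w
  have hc : ∀ k, ContDiffOn ℝ ∞ (fun y => ⟪e k y, ξ y⟫) O := fun k => (he.smooth k).inner ℝ hξ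
  have key : ∀ v w, normalDeriv X (normalDeriv X ξ w) v x
      = ∑ k, (fderiv ℝ (fun y => fderiv ℝ (fun y => ⟪e k y, ξ y⟫) y w) x v) • e k x := by
    intro v w
    have heq : ∀ y ∈ O, normalDeriv X ξ w y
        = ∑ k, (fderiv ℝ (fun y => ⟪e k y, ξ y⟫) y w) • e k y :=
      fun y hy => he.normalDeriv_eq_sum hO hξ hn hy w
    have hsm : ContDiffOn ℝ ∞ (normalDeriv X ξ w) O := by
      refine ContDiffOn.congr ?_ heq
      exact ContDiffOn.sum fun k _ => ((hc k).fderiv_apply_const hO w).smul (he.smooth k)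
    rw [he.normalDeriv_eq_sum hO hsm (fun y _ => Submodule.starProjection_apply_mem _ _) hx]
    refine Finset.sum_congr rfl fun k _ => ?_
    have : (fun y => ⟪e k y, normalDeriv X ξ w y⟫) =ᶠ[nhds x]
        fun y => fderiv ℝ (fun y => ⟪e k y, ξ y⟫) y w := by
      refine Filter.eventually_of_mem (hO.mem_nhds hx) fun y hy => ?_
      simp only [heq y hy]
      exact (he.orthonormal y hy).inner_right_fintype _ k
    rw [this.fderiv_eq]
  rw [key, key]
  refine Finset.sum_congr rfl fun k _ => ?_
  rw [fderiv_fderiv_comm (hc k) hO hx]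

/-- Differentiating `⟨dX(v), e_k⟩ = 0` in the direction `w` trades `D²X` for `de_k` with a change of
sign. -/
lemma secondForm_eq_sum (he : IsParallelNormalFrame O X e) (hO : IsOpen O)
    (hX : ContDiffOn ℝ ∞ X O) (hx : x ∈ O) (v w : Euc d) :
    secondForm X x v w = ∑ k, ⟪fderiv ℝ X x v, fderiv ℝ (e k) x w⟫ • e k x := by
  rw [secondForm, starProjection_eq_sum (he.orthonormal x hx) (he.span_eq x hx),
    ← Finset.sum_neg_distrib]
  refine Finset.sum_congr rfl fun k _ => ?_
  have hd := (hX.fderiv_apply_const hO v).differentiableAt_of_isOpen hO hx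
  have h0 : (fun y => ⟪fderiv ℝ X y v, e k y⟫) =ᶠ[nhds x] fun _ => 0 :=
    Filter.eventually_of_mem (hO.mem_nhds hx) fun y hy =>
      (mem_normalSpace_iff _).1 (he.mem_normalSpace hy k) v
  have h1 := fderiv_inner_apply ℝ hd (he.differentiableAt hO hx k) w
  rw [h0.fderiv_eq] at h1
  simp only [fderiv_fun_const, Pi.zero_apply, zero_apply] at h1
  rw [← neg_smul, real_inner_comm]
  congr 1
  linarith

end IsParallelNormalFrame

/-- The endomorphism `diag(u_i / a_i²)`. -/
noncomputable def scaledDiagonal (a : Fin d → ℝ) : (Fin d → ℝ) →ₗ[ℝ] (Euc d →ₗ[ℝ] Euc d) where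
  toFun u :=
    { toFun := fun v => WithLp.toLp 2 fun i => u i / a i ^ 2 * v i
      map_add' := fun v w => by ext i; simp [mul_add]
      map_smul' := fun c v => by ext i; simp; ring }
  map_add' u u' := by ext v i; simp; ring
  map_smul' c u := by ext v i; simp; ring

lemma scaledDiagonal_apply (a u : Fin d → ℝ) (v : Euc d) (i : Fin d) :
    scaledDiagonal a u v i = u i / a i ^ 2 * v i := rfl

lemma scaledDiagonal_injective {a : Fin d → ℝ} (ha : ∀ i, a i ≠ 0) :
    Function.Injective (scaledDiagonal a) := by
  intro u u' h
  funext i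
  have := congrArg (fun T : Euc d →ₗ[ℝ] Euc d => T (EuclideanSpace.single i 1) i) h
  simp only [scaledDiagonal_apply, PiLp.single_apply, if_true, mul_one] at this
  have h2 : a i ^ 2 ≠ 0 := pow_ne_zero 2 (ha i)
  exact (div_left_inj' h2).1 this

/-- The space of shape operators of a submanifold with diagonal fundamental forms. -/
lemma shapeOperators_eq {a : Fin d → ℝ} (ha : ∀ i, a i ≠ 0) {h : Matrix (Fin p) (Fin d) ℝ}
    {u : Fin p → Euc m} (hu : Orthonormal ℝ u)
    (hspan : Submodule.span ℝ (Set.range u) = normalSpace X x)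
    (hI : ∀ v w, firstForm X x v w = ∑ i, a i ^ 2 * (v i * w i))
    (hII : ∀ v w, secondForm X x v w = ∑ i, ∑ k, (h k i * (v i * w i)) • u k) :
    shapeOperators X x
      = (LinearMap.range hᵀ.mulVecLin).map (scaledDiagonal a) := by
  have hII' : ∀ v w ξ, ⟪secondForm X x v w, ξ⟫ = ∑ i, (∑ k, h k i * ⟪u k, ξ⟫) * (v i * w i) := by
    intro v w ξ
    simp only [hII, sum_inner, inner_smul_left, Finset.sum_mul]
    refine Finset.sum_congr rfl fun i _ => Finset.sum_congr rfl fun k _ => ?_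
    simp; ring
  ext S
  simp only [shapeOperators, Set.mem_ofPred_eq, Submodule.map_coe, Set.mem_image, SetLike.mem_coe,
    LinearMap.mem_range]
  constructor
  · rintro ⟨ξ, -, hS⟩
    -- Testing against the `i`-th basis vector gives `a_i² (S v)_i = (hᵗ t)_i v_i`, where `t` is the
    -- coefficient vector of `ξ`.
    refine ⟨_, ⟨fun k => ⟪u k, ξ⟫, rfl⟩, ?_⟩
    refine LinearMap.ext fun v => ?_
    ext i
    have h1 := hS v (EuclideanSpace.single i 1)
    rw [hI, hII'] at h1
    simp only [PiLp.single_apply, mul_ite, mul_one, mul_zero, Finset.sum_ite_eq',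
      Finset.mem_univ, if_true] at h1
    have h2 : a i ^ 2 ≠ 0 := pow_ne_zero 2 (ha i)
    rw [scaledDiagonal_apply, div_mul_eq_mul_div, div_eq_iff h2, mul_comm _ (a i ^ 2), h1]
    rfl
  · rintro ⟨_, ⟨t, rfl⟩, rfl⟩
    refine ⟨∑ k, t k • u k, ?_, fun v w => ?_⟩
    · rw [← hspan]
      exact Submodule.sum_mem _ fun k _ => Submodule.smul_mem _ _
        (Submodule.subset_span (Set.mem_range_self k))
    · rw [hI, hII']
      refine Finset.sum_congr rfl fun i _ => ?_
      have h2 : a i ^ 2 ≠ 0 := pow_ne_zero 2 (ha i)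
      simp only [scaledDiagonal_apply, hu.inner_right_fintype]
      simp only [Matrix.mulVecLin_apply, Matrix.mulVec, dotProduct, Matrix.transpose_apply]
      rw [div_mul_eq_mul_div, div_mul_eq_mul_div, mul_div_cancel₀ _ h2, mul_assoc]

/-- The shape operators already form a linear space, an injective image of the range of `hᵗ`, and
transposition preserves rank. -/
lemma finrank_span_shapeOperators {a : Fin d → ℝ} (ha : ∀ i, a i ≠ 0)
    {h : Matrix (Fin p) (Fin d) ℝ} {u : Fin p → Euc m} (hu : Orthonormal ℝ u)
    (hspan : Submodule.span ℝ (Set.range u) = normalSpace X x)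
    (hI : ∀ v w, firstForm X x v w = ∑ i, a i ^ 2 * (v i * w i))
    (hII : ∀ v w, secondForm X x v w = ∑ i, ∑ k, (h k i * (v i * w i)) • u k) :
    Module.finrank ℝ (Submodule.span ℝ (shapeOperators X x)) = h.rank := by
  rw [shapeOperators_eq ha hu hspan hI hII, Submodule.span_eq,
    ← (Submodule.equivMapOfInjective _ (scaledDiagonal_injective ha) _).finrank_eq]
  exact Matrix.rank_transpose h

/-- The normal bundle of a submanifold with fundamental forms `∑ a_i² dx_i²` and
`c ∑ g_{ki} a_i dx_i² e_k` is non-degenerate if and only if `G` has full rank. -/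
lemma nondegenerateAt_iff {a : Fin d → ℝ} (ha : ∀ i, a i ≠ 0) {c : ℝ} (hc : c ≠ 0)
    {G : Matrix (Fin p) (Fin d) ℝ} {u : Fin p → Euc m} (hu : Orthonormal ℝ u)
    (hspan : Submodule.span ℝ (Set.range u) = normalSpace X x)
    (hI : ∀ v w, firstForm X x v w = ∑ i, a i ^ 2 * (v i * w i))
    (hII : ∀ v w, secondForm X x v w = ∑ i, ∑ k, (-(c * (G k i * a i)) * (v i * w i)) • u k) :
    NondegenerateAt X x ↔ G.rank = d := by
  -- The coefficient matrix is `G` with its columns scaled by non-zero factors, which preserves the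
  -- rank.
  have hh : (Matrix.of fun k i => -(c * (G k i * a i)))
      = G * Matrix.diagonal fun i => -(c * a i) := by
    ext k i
    simp only [Matrix.of_apply, Matrix.mul_diagonal]
    ring
  have hdet : IsUnit (Matrix.diagonal fun i => -(c * a i)).det := by
    rw [Matrix.det_diagonal, isUnit_iff_ne_zero]
    exact Finset.prod_ne_zero_iff.2 fun i _ => neg_ne_zero.2 (mul_ne_zero hc (ha i))
  rw [NondegenerateAt, finrank_span_shapeOperators ha hu hspan hI
    (h := Matrix.of fun k i => -(c * (G k i * a i))) hII, hh,
    Matrix.rank_mul_eq_left_of_isUnit_det _ _ hdet]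

end NormalFrame

/-! ### Geometry of the columns of `X` -/

section TupleOfFrame

variable {n p m : ℕ} {F : Euc (n + 1) → Matrix (Fin (n + 1)) (Fin (n + 1)) ℝ}
  {G : Euc (n + 1) → Matrix (Fin p) (Fin (n + 1)) ℝ}
  {B : Euc (n + 1) → Matrix (Fin (n + 1)) (Fin (n + 1)) ℝ}
  {A : Euc (n + 1) → Matrix (Fin m) (Fin (n + 1) ⊕ Fin p) ℝ}
  {X : Euc (n + 1) → Matrix (Fin m) (Fin (n + 1)) ℝ}

lemma inner_colMap {k : ℕ} {κ κ' : Type*} (M : Euc k → Matrix (Fin m) κ ℝ)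
    (N : Euc k → Matrix (Fin m) κ' ℝ) (i : κ) (j : κ') (x : Euc k) :
    ⟪colMap M i x, colMap N j x⟫ = ((M x)ᵀ * N x) i j := by
  rw [PiLp.inner_apply]
  simp [colMap, Matrix.mul_apply, mul_comm]

namespace IsAdaptedFrame

lemma orthonormal_colMap (hA : IsAdaptedFrame F G A) (x : Euc (n + 1)) :
    Orthonormal ℝ fun c => colMap A c x := by
  rw [orthonormal_iff_ite]
  intro i j
  rw [inner_colMap, (hA.orthogonal x).1, Matrix.one_apply]

lemma eq_sum_colMap (hA : IsAdaptedFrame F G A) (x : Euc (n + 1)) (w : Euc m) :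
    w = ∑ c, ⟪colMap A c x, w⟫ • colMap A c x := by
  have h : w.ofLp = (A x * (A x)ᵀ) *ᵥ w.ofLp := by rw [(hA.orthogonal x).2, Matrix.one_mulVec]
  ext a
  rw [← Matrix.mulVec_mulVec] at h
  conv_lhs => rw [h]
  simp only [Matrix.mulVec, dotProduct, Matrix.transpose_apply, WithLp.ofLp_sum, WithLp.ofLp_smul,
    Finset.sum_apply, Pi.smul_apply, smul_eq_mul]
  refine Finset.sum_congr rfl fun c _ => ?_
  rw [mul_comm]
  congr 1
  rw [PiLp.inner_apply]
  simp [colMap, mul_comm]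

lemma vpderiv_colMap_inr (hA : IsAdaptedFrame F G A) (i : Fin (n + 1)) (k : Fin p)
    (x : Euc (n + 1)) :
    vpderiv i (colMap A (Sum.inr k)) x = G x k i • colMap A (Sum.inl i) x := by
  ext a
  rw [vpderiv_colMap hA.smooth isOpen_univ (Set.mem_univ x)]
  exact hA.pderiv_inr i k x a

lemma fderiv_colMap_inr (hA : IsAdaptedFrame F G A) (k : Fin p) (x v : Euc (n + 1)) :
    fderiv ℝ (colMap A (Sum.inr k)) x v = ∑ i, (v i * G x k i) • colMap A (Sum.inl i) x := by
  rw [fderiv_apply_eq_sum]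
  simp only [hA.vpderiv_colMap_inr, smul_smul]

end IsAdaptedFrame

/-- `X` is a smooth solution of `dX = -∑ i, A₁ C_i Bᵗ J dx_i`. -/
structure IsPrimitive (A : Euc (n + 1) → Matrix (Fin m) (Fin (n + 1) ⊕ Fin p) ℝ)
    (B : Euc (n + 1) → Matrix (Fin (n + 1)) (Fin (n + 1)) ℝ)
    (X : Euc (n + 1) → Matrix (Fin m) (Fin (n + 1)) ℝ) : Prop where
  smooth : MatSmoothOn Set.univ X
  deriv_eq : ∀ x i, matPderiv i X x = -((A x).toCols₁ * unitC i * (B x)ᵀ * lorentzJ n)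

namespace IsPrimitive

lemma vpderiv_colMap (hX : IsPrimitive A B X) (i j : Fin (n + 1)) (x : Euc (n + 1)) :
    vpderiv i (colMap X j) x = (-(lorentzSign n j * B x j i)) • colMap A (Sum.inl i) x := by
  ext a
  rw [_root_.vpderiv_colMap hX.smooth isOpen_univ (Set.mem_univ x), hX.deriv_eq, Matrix.neg_apply,
    toCols₁_mul_unitC_apply]
  simp [colMap]
  ring

lemma fderiv_colMap (hX : IsPrimitive A B X) (j : Fin (n + 1)) (x v : Euc (n + 1)) :
    fderiv ℝ (colMap X j) x v
      = ∑ i, (v i * -(lorentzSign n j * B x j i)) • colMap A (Sum.inl i) x := by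
  rw [fderiv_apply_eq_sum]
  simp only [hX.vpderiv_colMap, smul_smul]

lemma coeff_ne_zero {b : ℝ} (j : Fin (n + 1)) (hb : b ≠ 0) : -(lorentzSign n j * b) ≠ 0 :=
  neg_ne_zero.2 (mul_ne_zero (lorentzSign_ne_zero j) hb)

/-- Each `(X_j)_{x_i}` is a non-zero multiple of `e_i`, so the tangent plane is spanned by `e_1, …,
e_{n+1}`, independently of `j`. -/
lemma mem_normalSpace_iff (hA : IsAdaptedFrame F G A) (hX : IsPrimitive A B X) {j : Fin (n + 1)}
    {x : Euc (n + 1)} (hB : ∀ i, B x j i ≠ 0) (w : Euc m) :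
    w ∈ normalSpace (colMap X j) x
      ↔ w ∈ Submodule.span ℝ (Set.range fun k => colMap A (Sum.inr k) x) := by
  have ho := hA.orthonormal_colMap x
  have h1 : w ∈ normalSpace (colMap X j) x ↔ ∀ i, ⟪colMap A (Sum.inl i) x, w⟫ = 0 := by
    rw [mem_normalSpace_iff_vpderiv]
    refine forall_congr' fun i => ?_
    rw [hX.vpderiv_colMap, inner_smul_left]
    simp [lorentzSign_ne_zero, hB i]
  rw [h1]
  constructor
  · intro h
    rw [hA.eq_sum_colMap x w, Fintype.sum_sum_type]
    simp only [h, zero_smul, Finset.sum_const_zero, zero_add]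
    exact Submodule.sum_mem _ fun k _ => Submodule.smul_mem _ _
      (Submodule.subset_span (Set.mem_range_self k))
  · intro h i
    obtain ⟨c, rfl⟩ := (Submodule.mem_span_range_iff_exists_fun ℝ).1 h
    rw [inner_sum]
    refine Finset.sum_eq_zero fun k _ => ?_
    rw [inner_smul_right, ho.inner_eq_zero (by simp : Sum.inl i ≠ Sum.inr k), mul_zero]

lemma isImmersionOn (hA : IsAdaptedFrame F G A) (hX : IsPrimitive A B X) {j : Fin (n + 1)}
    (hB : ∀ x i, B x j i ≠ 0) : IsImmersionOn Set.univ (colMap X j) := by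
  refine ⟨contDiffOn_colMap hX.smooth j, fun x _ => ?_⟩
  rw [injective_iff_map_eq_zero]
  intro v hv
  rw [hX.fderiv_colMap] at hv
  ext i
  have ho := (hA.orthonormal_colMap x).comp _ Sum.inl_injective
  have h : ⟪colMap A (Sum.inl i) x, ∑ i, (v i * -(lorentzSign n j * B x j i)) •
      colMap A (Sum.inl i) x⟫ = _ := ho.inner_right_fintype _ i
  rw [hv, inner_zero_right] at h
  simpa using (mul_eq_zero.1 h.symm).resolve_right (coeff_ne_zero j (hB x i))

lemma isParallelNormalFrame (hA : IsAdaptedFrame F G A) (hX : IsPrimitive A B X)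
    {j : Fin (n + 1)} (hB : ∀ x i, B x j i ≠ 0) :
    IsParallelNormalFrame Set.univ (colMap X j) fun k => colMap A (Sum.inr k) := by
  refine ⟨fun k => contDiffOn_colMap hA.smooth _, fun x _ =>
    (hA.orthonormal_colMap x).comp _ Sum.inr_injective,
    fun x _ => Submodule.ext fun w => (mem_normalSpace_iff hA hX (hB x) w).symm,
    fun x _ k v => ?_⟩
  rw [normalDeriv, starProjection_eq_sum ((hA.orthonormal_colMap x).comp _ Sum.inr_injective)
    (Submodule.ext fun w => (mem_normalSpace_iff hA hX (hB x) w).symm)]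
  refine Finset.sum_eq_zero fun l _ => ?_
  rw [hA.fderiv_colMap_inr, inner_sum, Finset.sum_eq_zero, zero_smul]
  intro i _
  rw [inner_smul_right]
  exact mul_eq_zero_of_right _
    ((hA.orthonormal_colMap x).inner_eq_zero (by simp : Sum.inr l ≠ Sum.inl i))

/-- The factor `-ε_j b_{ji}` of `(X_j)_{x_i}` is squared in `I_j`, where `ε_j² = 1`, but enters
linearly in `II_j`, paired with the factor `g_{ki}` from the normal frame. -/
lemma hasTupleForms (hA : IsAdaptedFrame F G A) (hX : IsPrimitive A B X) {j : Fin (n + 1)}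
    (hB : ∀ x i, B x j i ≠ 0) :
    HasTupleForms Set.univ (colMap X j) (fun k => colMap A (Sum.inr k)) B G j := by
  have ho : ∀ x, Orthonormal ℝ fun i => colMap A (Sum.inl i) x := fun x =>
    (hA.orthonormal_colMap x).comp _ Sum.inl_injective
  refine ⟨fun x _ v w => ?_, fun x _ v w => ?_⟩
  · rw [firstForm, hX.fderiv_colMap, hX.fderiv_colMap, (ho x).inner_sum]
    refine Finset.sum_congr rfl fun i _ => ?_
    have := lorentzSign_mul_self j
    simp only [conj_trivial]
    linear_combination (B x j i ^ 2 * (v i * w i)) * this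
  · rw [(isParallelNormalFrame hA hX hB).secondForm_eq_sum isOpen_univ
      (contDiffOn_colMap hX.smooth j) (Set.mem_univ x), Finset.sum_comm]
    refine Finset.sum_congr rfl fun k _ => ?_
    rw [hX.fderiv_colMap, hA.fderiv_colMap_inr, (ho x).inner_sum, Finset.sum_smul]
    refine Finset.sum_congr rfl fun i _ => ?_
    congr 1
    simp only [conj_trivial, Matrix.of_apply]
    ring

lemma isHyperbolicCurvatureCoords {e : Fin p → Euc (n + 1) → Euc m} {O : Set (Euc (n + 1))}
    {Z : Euc (n + 1) → Euc m}
    (hBs : MatSmoothOn O B) (hGs : MatSmoothOn O G) (hBO : ∀ x ∈ O, B x ∈ lorentzO n)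
    {j : Fin (n + 1)} (hf : HasTupleForms O Z e B G j) : IsHyperbolicCurvatureCoords O Z e := by
  refine ⟨_, _, fun i => hBs j i, fun k i => ?_, hf, ?_⟩
  · exact (contDiffOn_const.mul ((hGs k i).mul (hBs j i))).neg
  · by_cases hj : j = Fin.last n
    · refine Or.inr fun x hx => ?_
      rw [lorentz_row_sum (hBO x hx), lorentzSign, if_pos hj]
    · refine Or.inl fun x hx => ?_
      rw [lorentz_row_sum (hBO x hx), lorentzSign, if_neg hj]

/-- If `B` has no zero entries, then the columns of `X` form a tuple of type `O(n,1)`. -/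
theorem isTuple {G : Euc (n + 1) → Matrix (Fin (m - (n + 1))) (Fin (n + 1)) ℝ}
    {A : Euc (n + 1) → Matrix (Fin m) (Fin (n + 1) ⊕ Fin (m - (n + 1))) ℝ}
    (h : IsSystemII Set.univ F G B) (hA : IsAdaptedFrame F G A) (hX : IsPrimitive A B X)
    (hB : ∀ x j i, B x j i ≠ 0) : IsTuple Set.univ (colMap X) := by
  have hfr := fun j => isParallelNormalFrame hA hX fun x i => hB x j i
  have hfo := fun j => hasTupleForms hA hX fun x i => hB x j i
  -- The definition of a tuple has no sign in `II_j`. Replacing `B` by `-J B` absorbs `-ε_j` into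
  -- row `j`; this matrix is again in `O(n,1)` and leaves `I_j` unchanged.
  refine ⟨isOpen_univ, isConnected_univ, fun j => isImmersionOn hA hX fun x i => hB x j i,
    fun j => (hfr j).hasFlatNormalBundle isOpen_univ, fun x hx i j => ?_, _, hfr,
    fun j => isHyperbolicCurvatureCoords h.smooth_B h.smooth_G h.mem_B (hfo j),
    fun x => -(lorentzJ n * B x), G, ?_, h.smooth_G, fun x hx => ?_, fun j => ?_⟩
  · rw [← (hfr i).span_eq x hx, (hfr j).span_eq x hx]
  · intro a b
    simp only [lorentzJ, Matrix.neg_apply, Matrix.diagonal_mul]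
    exact (contDiffOn_const.mul (h.smooth_B a b)).neg
  · have hBx : (B x)ᵀ * lorentzJ n * B x = lorentzJ n := h.mem_B x hx
    have hJ : (lorentzJ n)ᵀ = lorentzJ n := Matrix.diagonal_transpose _
    change (-(lorentzJ n * B x))ᵀ * lorentzJ n * -(lorentzJ n * B x) = lorentzJ n
    rw [Matrix.transpose_neg, Matrix.neg_mul, Matrix.neg_mul, Matrix.mul_neg, neg_neg,
      Matrix.transpose_mul, hJ, Matrix.mul_assoc (B x)ᵀ, lorentzJ_mul_self, Matrix.mul_one,
      ← Matrix.mul_assoc, hBx]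
  · have hBx : ∀ x i, (-(lorentzJ n * B x)) j i = -(lorentzSign n j * B x j i) := by
      intro x i
      rw [Matrix.neg_apply, lorentzJ, Matrix.diagonal_mul]
    refine ⟨fun x hx v w => ?_, fun x hx v w => ?_⟩
    · rw [(hfo j).1 x hx]
      refine Finset.sum_congr rfl fun i _ => ?_
      simp only [hBx]
      have := lorentzSign_mul_self j
      linear_combination (-B x j i ^ 2 * (v i * w i)) * this
    · rw [(hfo j).2 x hx]
      refine Finset.sum_congr rfl fun i _ => Finset.sum_congr rfl fun k _ => ?_
      simp only [Matrix.of_apply, hBx]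
      congr 1
      ring

end IsPrimitive

end TupleOfFrame

/-! ### The system for the principal frame of a tuple -/

section PrincipalFrame

variable {n p m : ℕ}

/-- `u` is the common principal frame of the maps `X_j`, which completes the normal frame `e` to an
orthonormal frame of `ℝ^m`. -/
structure IsPrincipalFrame (O : Set (Euc (n + 1))) (X : Fin (n + 1) → Euc (n + 1) → Euc m)
    (e : Fin p → Euc (n + 1) → Euc m)
    (B : Euc (n + 1) → Matrix (Fin (n + 1)) (Fin (n + 1)) ℝ)
    (G : Euc (n + 1) → Matrix (Fin p) (Fin (n + 1)) ℝ)
    (u : Fin (n + 1) → Euc (n + 1) → Euc m) : Prop where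
  isOpen : IsOpen O
  smooth_X : ∀ j, ContDiffOn ℝ ∞ (X j) O
  smooth_e : ∀ k, ContDiffOn ℝ ∞ (e k) O
  smooth_u : ∀ i, ContDiffOn ℝ ∞ (u i) O
  smooth_B : MatSmoothOn O B
  smooth_G : MatSmoothOn O G
  mem_B : ∀ x ∈ O, B x ∈ lorentzO n
  B_ne_zero : ∀ x ∈ O, ∀ i, B x 0 i ≠ 0
  orthonormal : ∀ x ∈ O, Orthonormal ℝ fun i => u i x
  inner_normal : ∀ x ∈ O, ∀ i k, ⟪u i x, e k x⟫ = 0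
  complete : ∀ x ∈ O, ∀ w : Euc m,
    w = ∑ c, ⟪u c x, w⟫ • u c x + ∑ k, ⟪e k x, w⟫ • e k x
  deriv_X : ∀ x ∈ O, ∀ i j, vpderiv i (X j) x = (-(lorentzSign n j * B x j i)) • u i x
  deriv_e : ∀ x ∈ O, ∀ i k, vpderiv i (e k) x = G x k i • u i x

namespace IsPrincipalFrame

variable {O : Set (Euc (n + 1))} {X : Fin (n + 1) → Euc (n + 1) → Euc m}
  {e : Fin p → Euc (n + 1) → Euc m}
  {B : Euc (n + 1) → Matrix (Fin (n + 1)) (Fin (n + 1)) ℝ}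
  {G : Euc (n + 1) → Matrix (Fin p) (Fin (n + 1)) ℝ}
  {u : Fin (n + 1) → Euc (n + 1) → Euc m} {x : Euc (n + 1)}

lemma differentiableAt_u (h : IsPrincipalFrame O X e B G u) (hx : x ∈ O) (i : Fin (n + 1)) :
    DifferentiableAt ℝ (u i) x :=
  (h.smooth_u i).differentiableAt_of_isOpen h.isOpen hx

lemma differentiableAt_B (h : IsPrincipalFrame O X e B G u) (hx : x ∈ O) (i j : Fin (n + 1)) :
    DifferentiableAt ℝ (fun y => B y i j) x :=
  (h.smooth_B i j).differentiableAt_of_isOpen h.isOpen hx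

lemma inner_u (h : IsPrincipalFrame O X e B G u) (hx : x ∈ O) (i j : Fin (n + 1)) :
    ⟪u i x, u j x⟫ = if i = j then 1 else 0 :=
  orthonormal_iff_ite.1 (h.orthonormal x hx) i j

lemma inner_eq_sum (h : IsPrincipalFrame O X e B G u) (hx : x ∈ O) (w z : Euc m) :
    ⟪w, z⟫ = ∑ c, ⟪u c x, w⟫ * ⟪u c x, z⟫ + ∑ k, ⟪e k x, w⟫ * ⟪e k x, z⟫ := by
  conv_lhs => rw [h.complete x hx w]
  simp [inner_add_left, sum_inner, inner_smul_left]

lemma ext_inner (h : IsPrincipalFrame O X e B G u) (hx : x ∈ O) {w z : Euc m}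
    (hu : ∀ c, ⟪u c x, w⟫ = ⟪u c x, z⟫) (he : ∀ k, ⟪e k x, w⟫ = ⟪e k x, z⟫) : w = z := by
  rw [h.complete x hx w, h.complete x hx z]
  simp only [hu, he]

lemma inner_vpderiv_add (h : IsPrincipalFrame O X e B G u) (hx : x ∈ O) (l i c : Fin (n + 1)) :
    ⟪u i x, vpderiv l (u c) x⟫ + ⟪vpderiv l (u i) x, u c x⟫ = 0 := by
  rw [← pderiv_inner (h.differentiableAt_u hx i) (h.differentiableAt_u hx c)]
  exact (vpderiv_congr h.isOpen hx (fun y hy => h.inner_u hy i c) l).trans (vpderiv_const _)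

lemma inner_vpderiv_self (h : IsPrincipalFrame O X e B G u) (hx : x ∈ O) (l i : Fin (n + 1)) :
    ⟪u i x, vpderiv l (u i) x⟫ = 0 := by
  have := h.inner_vpderiv_add hx l i i
  rw [real_inner_comm (u i x)] at this
  linarith

lemma inner_normal_vpderiv (h : IsPrincipalFrame O X e B G u) (hx : x ∈ O) (l i : Fin (n + 1))
    (k : Fin p) : ⟪e k x, vpderiv l (u i) x⟫ = if i = l then -G x k l else 0 := by
  have h0 : ⟪u i x, vpderiv l (e k) x⟫ + ⟪vpderiv l (u i) x, e k x⟫ = 0 := by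
    rw [← pderiv_inner (h.differentiableAt_u hx i)
      ((h.smooth_e k).differentiableAt_of_isOpen h.isOpen hx)]
    exact (vpderiv_congr h.isOpen hx (fun y hy => h.inner_normal y hy i k) l).trans
      (vpderiv_const _)
  rw [h.deriv_e x hx, inner_smul_right, h.inner_u hx] at h0
  rw [real_inner_comm]
  split_ifs at h0 ⊢ <;> linarith

/-- Equality of the mixed second derivatives of `X_j`, with the common factor `-ε_j` cancelled. -/
lemma compatibility (h : IsPrincipalFrame O X e B G u) (hx : x ∈ O) (i l j : Fin (n + 1)) :
    pderiv l (fun y => B y j i) x • u i x + B x j i • vpderiv l (u i) x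
      = pderiv i (fun y => B y j l) x • u l x + B x j l • vpderiv i (u l) x := by
  have key : ∀ i l, vpderiv l (vpderiv i (X j)) x = -lorentzSign n j •
      (pderiv l (fun y => B y j i) x • u i x + B x j i • vpderiv l (u i) x) := by
    intro i l
    rw [vpderiv_congr h.isOpen hx (fun y hy => h.deriv_X y hy i j) l,
      vpderiv_smul ((h.differentiableAt_B hx j i).const_mul _).fun_neg (h.differentiableAt_u hx i),
      pderiv_neg, pderiv_const_mul _ (h.differentiableAt_B hx j i)]
    module
  have := vpderiv_comm (h.smooth_X j) h.isOpen hx l i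
  rw [key, key] at this
  exact smul_right_injective _ (neg_ne_zero.2 (lorentzSign_ne_zero j)) this

/-- The `u_i`-component of the compatibility relation. The ratio of `(b_{ji})_{x_l}` to `b_{jl}` is
thus the same for all `j`, so the first row determines it and `F` can be defined from that row. -/
lemma pderiv_B_eq (h : IsPrincipalFrame O X e B G u) (hx : x ∈ O) {i l : Fin (n + 1)}
    (hil : i ≠ l) (j : Fin (n + 1)) :
    pderiv l (fun y => B y j i) x = B x j l * ⟪u i x, vpderiv i (u l) x⟫ := by
  have := congrArg (fun w => ⟪u i x, w⟫) (h.compatibility hx i l j)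
  simpa only [inner_add_right, inner_smul_right, h.inner_u hx, if_true, if_neg hil,
    h.inner_vpderiv_self hx, mul_one, mul_zero, add_zero, zero_add] using this

lemma inner_u_vpderiv (h : IsPrincipalFrame O X e B G u) (hx : x ∈ O) {i l : Fin (n + 1)}
    (hil : i ≠ l) : ⟪u i x, vpderiv i (u l) x⟫ = rotationMatrix B x l i := by
  simp only [rotationMatrix, Matrix.of_apply, if_neg hil.symm]
  rw [h.pderiv_B_eq hx hil, mul_div_cancel_left₀ _ (h.B_ne_zero x hx l)]

/-- The `u_c`-component of compatibility is `b_{ji} s = b_{jl} t` for all `j`, with `s, t`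
independent of `j`. Multiplying by `ε_j b_{ji}` and summing gives `ε_i s = 0`, since columns `i` and
`l` of `B` are Lorentz-orthogonal. -/
lemma inner_u_vpderiv_of_ne (h : IsPrincipalFrame O X e B G u) (hx : x ∈ O)
    {i l c : Fin (n + 1)} (hil : i ≠ l) (hci : c ≠ i) (hcl : c ≠ l) :
    ⟪u c x, vpderiv l (u i) x⟫ = 0 := by
  have hj : ∀ j, B x j i * ⟪u c x, vpderiv l (u i) x⟫ = B x j l * ⟪u c x, vpderiv i (u l) x⟫ := by
    intro j
    have := congrArg (fun w => ⟪u c x, w⟫) (h.compatibility hx i l j)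
    simpa only [inner_add_right, inner_smul_right, h.inner_u hx, if_neg hci, if_neg hcl,
      mul_zero, zero_add] using this
  have hBx : (B x)ᵀ * lorentzJ n * B x = lorentzJ n := h.mem_B x hx
  have hentry : ∀ l, ∑ j, lorentzSign n j * B x j i * B x j l = lorentzJ n i l := by
    intro l
    rw [← hBx, Matrix.mul_apply]
    simp only [lorentzJ, Matrix.mul_diagonal, Matrix.transpose_apply]
    exact Finset.sum_congr rfl fun j _ => by ring
  have h1 : (∑ j, lorentzSign n j * B x j i * B x j i) * ⟪u c x, vpderiv l (u i) x⟫
      = (∑ j, lorentzSign n j * B x j i * B x j l) * ⟪u c x, vpderiv i (u l) x⟫ := by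
    rw [Finset.sum_mul, Finset.sum_mul]
    refine Finset.sum_congr rfl fun j _ => ?_
    rw [mul_assoc, hj, ← mul_assoc]
  rw [hentry, hentry, lorentzJ, Matrix.diagonal_apply_eq, Matrix.diagonal_apply_ne _ hil,
    zero_mul] at h1
  exact (mul_eq_zero.1 h1).resolve_left (lorentzSign_ne_zero i)

/-- The derivative of `u_i` in a direction other than the `i`-th one. -/
lemma vpderiv_u (h : IsPrincipalFrame O X e B G u) (hx : x ∈ O) {i l : Fin (n + 1)}
    (hil : i ≠ l) : vpderiv l (u i) x = rotationMatrix B x i l • u l x := by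
  refine h.ext_inner hx (fun c => ?_) fun k => ?_
  · rw [inner_smul_right, h.inner_u hx]
    by_cases hcl : c = l
    · subst hcl
      rw [if_pos rfl, mul_one, h.inner_u_vpderiv hx hil.symm]
    · rw [if_neg hcl, mul_zero]
      by_cases hci : c = i
      · subst hci
        exact h.inner_vpderiv_self hx l c
      · exact h.inner_u_vpderiv_of_ne hx hil hci hcl
  · rw [h.inner_normal_vpderiv hx, if_neg hil, inner_smul_right, real_inner_comm,
      h.inner_normal x hx, mul_zero]

lemma rotationMatrix_self (i : Fin (n + 1)) : rotationMatrix B x i i = 0 := by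
  simp [rotationMatrix]

lemma inner_u_vpderiv_diag (h : IsPrincipalFrame O X e B G u) (hx : x ∈ O) (c i : Fin (n + 1)) :
    ⟪u c x, vpderiv i (u i) x⟫ = -rotationMatrix B x c i := by
  by_cases hci : c = i
  · subst hci
    rw [h.inner_vpderiv_self hx, rotationMatrix_self, neg_zero]
  · have := h.inner_vpderiv_add hx i c i
    rw [h.vpderiv_u hx hci, inner_smul_left, h.inner_u hx, if_pos rfl] at this
    simp only [conj_trivial, mul_one] at this
    linarith

lemma matSmoothOn_rotationMatrix (h : IsPrincipalFrame O X e B G u) :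
    MatSmoothOn O (rotationMatrix B) := by
  intro i j
  by_cases hij : i = j
  · subst hij
    simp only [rotationMatrix_self]
    exact contDiffOn_const
  · simp only [rotationMatrix, Matrix.of_apply, if_neg hij]
    exact ((h.smooth_B 0 j).vpderiv h.isOpen i).div (h.smooth_B 0 i)
      fun y hy => h.B_ne_zero y hy i

lemma differentiableAt_rotationMatrix (h : IsPrincipalFrame O X e B G u) (hx : x ∈ O)
    (i j : Fin (n + 1)) : DifferentiableAt ℝ (fun y => rotationMatrix B y i j) x :=
  (h.matSmoothOn_rotationMatrix i j).differentiableAt_of_isOpen h.isOpen hx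

lemma inner_u_vpderiv_smul (h : IsPrincipalFrame O X e B G u) (hx : x ∈ O) {a : Euc (n + 1) → ℝ}
    (ha : DifferentiableAt ℝ a x) (c l i : Fin (n + 1)) :
    ⟪u c x, vpderiv l (fun y => a y • u i y) x⟫
      = (if c = i then pderiv l a x else 0) + a x * ⟪u c x, vpderiv l (u i) x⟫ := by
  rw [vpderiv_smul ha (h.differentiableAt_u hx i), inner_add_right, inner_smul_right,
    inner_smul_right, h.inner_u hx, mul_ite, mul_one, mul_zero]

/-- The Gauss, Codazzi and Ricci equations of a principal frame form the system. -/
theorem isSystemII (h : IsPrincipalFrame O X e B G u) :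
    IsSystemII O (rotationMatrix B) G B where
  smooth_F := h.matSmoothOn_rotationMatrix
  smooth_G := h.smooth_G
  smooth_B := h.smooth_B
  diag_F x _ i := rotationMatrix_self i
  mem_B := h.mem_B
  eq_gauss x hx i j hij := by
    -- The `u_j`-component of `(u_i)_{x_i x_j}` is computed twice: from `(u_i)_{x_j} = f_{ij} u_j`,
    -- and by differentiating `⟨u_j, (u_i)_{x_i}⟩ = -f_{ji}`. The second way leaves `⟨(u_j)_{x_j},
    -- (u_i)_{x_i}⟩`, whose expansion in the frame gives the two quadratic sums.
    have h1 := vpderiv_comm (h.smooth_u i) h.isOpen hx i j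
    have h2 : ⟪u j x, vpderiv i (vpderiv j (u i)) x⟫
        = pderiv i (fun y => rotationMatrix B y i j) x := by
      rw [vpderiv_congr h.isOpen hx (fun y hy => h.vpderiv_u hy hij) i,
        h.inner_u_vpderiv_smul hx (h.differentiableAt_rotationMatrix hx i j),
        h.inner_vpderiv_self hx, if_pos rfl, mul_zero, add_zero]
    have h3 : pderiv j (fun y => ⟪u j y, vpderiv i (u i) y⟫) x
        = -pderiv j (fun y => rotationMatrix B y j i) x := by
      rw [← pderiv_neg]
      exact vpderiv_congr h.isOpen hx (fun y hy => h.inner_u_vpderiv_diag hy j i) j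
    rw [pderiv_inner (h.differentiableAt_u hx j)
      (((h.smooth_u i).vpderiv h.isOpen i).differentiableAt_of_isOpen h.isOpen hx), ← h1, h2,
      h.inner_eq_sum hx (vpderiv j (u j) x)] at h3
    simp only [h.inner_u_vpderiv_diag hx, h.inner_normal_vpderiv hx, if_true, neg_mul_neg] at h3
    have e1 : ∑ k, rotationMatrix B x k j * rotationMatrix B x k i
        = ∑ k, rotationMatrix B x k i * rotationMatrix B x k j :=
      Finset.sum_congr rfl fun k _ => mul_comm _ _
    have e2 : ∑ k, G x k j * G x k i = ∑ k, G x k i * G x k j :=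
      Finset.sum_congr rfl fun k _ => mul_comm _ _
    linarith
  eq_F x hx i j k hij hik hjk := by
    -- Compare the `u_j`-components of `(f_{ij} u_j)_{x_k}` and `(f_{ik} u_k)_{x_j}`.
    have h1 := congrArg (fun w => ⟪u j x, w⟫) (vpderiv_comm (h.smooth_u i) h.isOpen hx k j)
    beta_reduce at h1
    rw [vpderiv_congr h.isOpen hx (fun y hy => h.vpderiv_u hy hij) k,
      vpderiv_congr h.isOpen hx (fun y hy => h.vpderiv_u hy hik) j,
      h.inner_u_vpderiv_smul hx (h.differentiableAt_rotationMatrix hx i j),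
      h.inner_u_vpderiv_smul hx (h.differentiableAt_rotationMatrix hx i k),
      h.inner_vpderiv_self hx, if_pos rfl, if_neg hjk, h.inner_u_vpderiv hx hjk] at h1
    linarith
  eq_B x hx i j k hjk := by
    rw [h.pderiv_B_eq hx hjk, h.inner_u_vpderiv hx hjk, mul_comm]
  eq_G x hx i j k hjk := by
    have hG : ∀ c, DifferentiableAt ℝ (fun y => G y i c) x := fun c =>
      (h.smooth_G i c).differentiableAt_of_isOpen h.isOpen hx
    have h1 := congrArg (fun w => ⟪u j x, w⟫) (vpderiv_comm (h.smooth_e i) h.isOpen hx k j)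
    beta_reduce at h1
    rw [vpderiv_congr h.isOpen hx (fun y hy => h.deriv_e y hy j i) k,
      vpderiv_congr h.isOpen hx (fun y hy => h.deriv_e y hy k i) j,
      h.inner_u_vpderiv_smul hx (hG j), h.inner_u_vpderiv_smul hx (hG k),
      h.inner_vpderiv_self hx, if_pos rfl, if_neg hjk, h.inner_u_vpderiv hx hjk] at h1
    linarith

end IsPrincipalFrame

end PrincipalFrame

/-! ### The principal frame of a tuple -/

section TupleFrame

variable {n p m : ℕ} {O : Set (Euc (n + 1))} {Z : Euc (n + 1) → Euc m}
  {e : Fin p → Euc (n + 1) → Euc m}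
  {B : Euc (n + 1) → Matrix (Fin (n + 1)) (Fin (n + 1)) ℝ}
  {G : Euc (n + 1) → Matrix (Fin p) (Fin (n + 1)) ℝ} {x : Euc (n + 1)} {j : Fin (n + 1)}

/-- The coordinate tangent vectors of `Z`, divided by `-ε_j b_{ji}`. -/
noncomputable def principalVector (B : Euc (n + 1) → Matrix (Fin (n + 1)) (Fin (n + 1)) ℝ)
    (j : Fin (n + 1)) (Z : Euc (n + 1) → Euc m) (i : Fin (n + 1)) (y : Euc (n + 1)) : Euc m :=
  (-(lorentzSign n j * B y j i))⁻¹ • vpderiv i Z y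

namespace HasTupleForms

lemma inner_vpderiv (hf : HasTupleForms O Z e B G j) (hx : x ∈ O) (i l : Fin (n + 1)) :
    ⟪vpderiv i Z x, vpderiv l Z x⟫ = if i = l then B x j i ^ 2 else 0 := by
  have h := hf.1 x hx (EuclideanSpace.single i 1) (EuclideanSpace.single l 1)
  rw [firstForm] at h
  refine h.trans ?_
  rw [Finset.sum_eq_single i]
  · by_cases hil : i = l <;> simp [PiLp.single_apply, hil]
  · intro c _ hc
    simp [PiLp.single_apply, hc]
  · simp

/-- The coordinate vector `Z_{x_i}` has squared length `b_{ji}²` and is non-zero for an immersion.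
-/
lemma B_ne_zero (hf : HasTupleForms O Z e B G j) (hZ : IsImmersionOn O Z) (hx : x ∈ O)
    (i : Fin (n + 1)) : B x j i ≠ 0 := by
  intro h0
  have h := hf.inner_vpderiv hx i i
  rw [if_pos rfl, h0, zero_pow two_ne_zero, inner_self_eq_zero] at h
  have h1 : EuclideanSpace.single i (1 : ℝ) = 0 :=
    (injective_iff_map_eq_zero _).1 (hZ.2 x hx) _ h
  simpa using congrArg (fun v : Euc (n + 1) => v i) h1

lemma vpderiv_eq (hf : HasTupleForms O Z e B G j) (hZ : IsImmersionOn O Z) (hx : x ∈ O)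
    (i : Fin (n + 1)) :
    vpderiv i Z x = (-(lorentzSign n j * B x j i)) • principalVector B j Z i x := by
  rw [principalVector, smul_inv_smul₀ (IsPrimitive.coeff_ne_zero j (hf.B_ne_zero hZ hx i))]

lemma orthonormal (hf : HasTupleForms O Z e B G j) (hZ : IsImmersionOn O Z) (hx : x ∈ O) :
    Orthonormal ℝ fun i => principalVector B j Z i x := by
  rw [orthonormal_iff_ite]
  intro i l
  have hne := hf.B_ne_zero hZ hx i
  have hs := lorentzSign_ne_zero j
  rw [principalVector, principalVector, inner_smul_left, inner_smul_right,
    hf.inner_vpderiv hx]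
  by_cases hil : i = l
  · subst hil
    have := lorentzSign_mul_self j
    simp only [conj_trivial, if_true]
    field_simp
    linear_combination -this
  · simp [hil]

lemma inner_vpderiv_normal (hf : HasTupleForms O Z e B G j) (hO : IsOpen O)
    (hZ : IsImmersionOn O Z) (he : IsParallelNormalFrame O Z e) (hx : x ∈ O)
    (l i : Fin (n + 1)) (k : Fin p) :
    ⟪vpderiv l Z x, vpderiv i (e k) x⟫
      = if l = i then -(lorentzSign n j * (G x k i * B x j i)) else 0 := by
  have h := hf.2 x hx (EuclideanSpace.single l 1) (EuclideanSpace.single i 1)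
  rw [he.secondForm_eq_sum hO hZ.1 hx, Finset.sum_comm] at h
  simp only [← Finset.sum_smul] at h
  have h2 := congrArg (fun w => ⟪e k x, w⟫) h
  beta_reduce at h2
  rw [(he.orthonormal x hx).inner_right_fintype, (he.orthonormal x hx).inner_right_fintype] at h2
  refine h2.trans ?_
  rw [Finset.sum_eq_single i]
  · by_cases hli : l = i
    · simp [hli]
    · simp [hli, Ne.symm hli]
  · intro c _ hc
    simp [PiLp.single_apply, hc]
  · simp

/-- The normal frame moves along the principal vectors. -/
lemma vpderiv_normal (hf : HasTupleForms O Z e B G j) (hO : IsOpen O)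
    (hZ : IsImmersionOn O Z) (he : IsParallelNormalFrame O Z e) (hx : x ∈ O)
    (i : Fin (n + 1)) (k : Fin p) :
    vpderiv i (e k) x = G x k i • principalVector B j Z i x := by
  -- The second fundamental form makes this difference normal. It is also orthogonal to normal
  -- vectors, because both terms are tangential, so its inner product with itself is zero.
  have hn : vpderiv i (e k) x - G x k i • principalVector B j Z i x ∈ normalSpace Z x := by
    rw [mem_normalSpace_iff_vpderiv]
    intro l
    rw [inner_sub_right, hf.inner_vpderiv_normal hO hZ he hx, inner_smul_right,
      principalVector, inner_smul_right, hf.inner_vpderiv hx]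
    by_cases hli : l = i
    · subst hli
      have hne := hf.B_ne_zero hZ hx l
      have hs := lorentzSign_ne_zero j
      have := lorentzSign_mul_self j
      simp only [if_true]
      field_simp
      linear_combination (-G x k l * B x j l) * this
    · simp [hli]
  rw [← sub_eq_zero, ← inner_self_eq_zero (𝕜 := ℝ)]
  nth_rewrite 1 [inner_sub_left]
  have h1 : ⟪vpderiv i (e k) x, vpderiv i (e k) x - G x k i • principalVector B j Z i x⟫ = 0 :=
    he.inner_fderiv_eq_zero hx k _ hn
  have h2 := (mem_normalSpace_iff_vpderiv _).1 hn i
  rw [h1, inner_smul_left, principalVector, inner_smul_left]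
  rw [principalVector] at h2
  rw [h2]
  simp

end HasTupleForms

/-- Non-degeneracy of the normal bundle excludes vanishing columns of `G`. -/
lemma exists_ne_zero_of_nondegenerateAt (hf : HasTupleForms O Z e B G j)
    (hZ : IsImmersionOn O Z) (he : IsParallelNormalFrame O Z e) (hx : x ∈ O)
    (hnd : NondegenerateAt Z x) (i : Fin (n + 1)) : ∃ k, G x k i ≠ 0 := by
  have hr := (nondegenerateAt_iff (fun i => hf.B_ne_zero hZ hx i) (lorentzSign_ne_zero j)
    (he.orthonormal x hx) (he.span_eq x hx) (hf.1 x hx) (hf.2 x hx)).1 hnd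
  by_contra! h0
  -- Full rank `n + 1` makes the `n + 1` columns independent, so none of them vanishes.
  have hli : LinearIndependent ℝ (G x).col := by
    rw [linearIndependent_iff_card_eq_finrank_span, Set.finrank, ← Matrix.rank_eq_finrank_span_cols,
      hr, Fintype.card_fin]
  exact hli.ne_zero i (funext h0)

/-- A tuple of type `O(n,1)` has a principal frame. -/
theorem IsTuple.exists_isPrincipalFrame {X : Fin (n + 1) → Euc (n + 1) → Euc m}
    (hX : IsTuple O X) (he : ∀ j, IsParallelNormalFrame O (X j) e) (hB : MatSmoothOn O B)
    (hG : MatSmoothOn O G) (hBO : ∀ x ∈ O, B x ∈ lorentzO n)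
    (hf : ∀ j, HasTupleForms O (X j) e B G j) (hG0 : ∀ x ∈ O, ∀ i, ∃ k, G x k i ≠ 0) :
    ∃ u, IsPrincipalFrame O X e B G u := by
  have hO := hX.isOpen
  have him := hX.immersion
  have hort : ∀ x ∈ O, ∀ i k, ⟪principalVector B 0 (X 0) i x, e k x⟫ = 0 := by
    intro x hx i k
    rw [principalVector, inner_smul_left,
      (mem_normalSpace_iff_vpderiv _).1 ((he 0).mem_normalSpace hx k) i, mul_zero]
  refine ⟨principalVector B 0 (X 0), hO, fun j => (him j).1, (he 0).smooth, fun i => ?_, hB, hG, hBO,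
    fun x hx i => (hf 0).B_ne_zero (him 0) hx i, fun x hx => (hf 0).orthonormal (him 0) hx,
    hort, fun x hx w => ?_, fun x hx i j => ?_,
    fun x hx i k => (hf 0).vpderiv_normal hO (him 0) (he 0) hx i k⟩
  · refine ContDiffOn.smul (ContDiffOn.inv (contDiffOn_const.mul (hB 0 i)).neg fun y hy => ?_)
      ((him 0).1.vpderiv hO i)
    exact IsPrimitive.coeff_ne_zero 0 ((hf 0).B_ne_zero (him 0) hy i)
  · have ho := (hf 0).orthonormal (him 0) hx
    have hn : w - ∑ c, ⟪principalVector B 0 (X 0) c x, w⟫ • principalVector B 0 (X 0) c x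
        ∈ normalSpace (X 0) x := by
      rw [mem_normalSpace_iff_vpderiv]
      intro i
      rw [(hf 0).vpderiv_eq (him 0) hx, inner_smul_left, inner_sub_right,
        ho.inner_right_fintype, sub_self, mul_zero]
    rw [← (he 0).span_eq x hx] at hn
    have h1 := mem_span_orthonormal_eq_sum ((he 0).orthonormal x hx) hn
    rw [sub_eq_iff_eq_add'] at h1
    refine h1.trans ?_
    congr 1
    refine Finset.sum_congr rfl fun k _ => ?_
    congr 1
    rw [inner_sub_right, inner_sum, Finset.sum_eq_zero, sub_zero]
    intro c _
    rw [inner_smul_right, real_inner_comm (principalVector B 0 (X 0) c x) (e k x), hort x hx, mul_zero]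
  -- The derivative of `e k` equals `g_{ki}` times the `i`-th principal vector of every `X_j`.
  -- Cancelling a non-zero `g_{ki}` identifies the principal vectors of `X_j` with those of the
  -- first immersion, signs included.
  · obtain ⟨k, hk⟩ := hG0 x hx i
    rw [(hf j).vpderiv_eq (him j) hx]
    congr 1
    refine smul_right_injective _ hk ?_
    beta_reduce
    rw [← (hf j).vpderiv_normal hO (him j) (he j) hx, (hf 0).vpderiv_normal hO (him 0) (he 0) hx]

end TupleFrame

theorem theorem7p4 (n m : ℕ) (hm : n + 1 < m) :
    -- from solutions of the system to tuples
    (∀ (F : Euc (n + 1) → Matrix (Fin (n + 1)) (Fin (n + 1)) ℝ)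
      (G : Euc (n + 1) → Matrix (Fin (m - (n + 1))) (Fin (n + 1)) ℝ)
      (B : Euc (n + 1) → Matrix (Fin (n + 1)) (Fin (n + 1)) ℝ),
      IsSystemII Set.univ F G B →
        -- (i)
        IsFlatSkewConnection (connCoeff F G) ∧
        (∃ A : Euc (n + 1) → Matrix (Fin m) (Fin (n + 1) ⊕ Fin (m - (n + 1))) ℝ,
          IsAdaptedFrame F G A) ∧
        ∀ A : Euc (n + 1) → Matrix (Fin m) (Fin (n + 1) ⊕ Fin (m - (n + 1))) ℝ,
          IsAdaptedFrame F G A →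
          -- (ii)
          (∃ Y : Euc (n + 1) → Matrix (Fin m) (Fin (n + 1)) ℝ, MatSmoothOn Set.univ Y ∧
            ∀ x i, matPderiv i Y x = (A x).toCols₁ * unitC i * lorentzJ n * (B x)⁻¹) ∧
          (∃ X : Euc (n + 1) → Matrix (Fin m) (Fin (n + 1)) ℝ, MatSmoothOn Set.univ X ∧
            ∀ x i, matPderiv i X x = -((A x).toCols₁ * unitC i * (B x)ᵀ * lorentzJ n)) ∧
          -- (iii)
          ∀ X : Euc (n + 1) → Matrix (Fin m) (Fin (n + 1)) ℝ, MatSmoothOn Set.univ X →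
            (∀ x i, matPderiv i X x = -((A x).toCols₁ * unitC i * (B x)ᵀ * lorentzJ n)) →
            (∀ j, (∀ x i, B x j i ≠ 0) →
              IsImmersionOn Set.univ (colMap X j) ∧
              HasFlatNormalBundle Set.univ (colMap X j) ∧
              IsParallelNormalFrame Set.univ (colMap X j) (fun k => colMap A (Sum.inr k)) ∧
              IsHyperbolicCurvatureCoords Set.univ (colMap X j)
                (fun k => colMap A (Sum.inr k)) ∧
              HasTupleForms Set.univ (colMap X j) (fun k => colMap A (Sum.inr k)) B G j ∧
              (∀ x, NondegenerateAt (colMap X j) x ↔ (G x).rank = n + 1)) ∧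
            ((∀ x j i, B x j i ≠ 0) → IsTuple Set.univ (colMap X))) ∧
    -- (iv) from tuples to solutions of the system
    (∀ (O : Set (Euc (n + 1))) (X : Fin (n + 1) → Euc (n + 1) → Euc m)
      (e : Fin (m - (n + 1)) → Euc (n + 1) → Euc m)
      (B : Euc (n + 1) → Matrix (Fin (n + 1)) (Fin (n + 1)) ℝ)
      (G : Euc (n + 1) → Matrix (Fin (m - (n + 1))) (Fin (n + 1)) ℝ),
      IsTuple O X →
      (∀ j, IsParallelNormalFrame O (X j) e) →
      MatSmoothOn O B → MatSmoothOn O G → (∀ x ∈ O, B x ∈ lorentzO n) →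
      (∀ j, HasTupleForms O (X j) e B G j) →
      ((∀ j, ∀ x ∈ O, NondegenerateAt (X j) x) ∨ (∀ x ∈ O, ∀ i, ∃ k, G x k i ≠ 0)) →
      IsSystemII O (rotationMatrix B) G B) := by
  refine ⟨fun F G B h => ⟨h.isFlatSkewConnection,
    exists_isAdaptedFrame (by omega) h.isFlatSkewConnection, fun A hA => ?_⟩,
    fun O X e B G hX he hB hG hBO hf hnd => ?_⟩
  · obtain ⟨Y, hYs, hY⟩ := hA.exists_primitive h
    refine ⟨⟨Y, hYs, fun x i => ?_⟩, ⟨fun x => -Y x, fun a l => (hYs a l).neg, fun x i => ?_⟩,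
      fun X hXs hXd => ?_⟩
    · rw [hY, mul_lorentz_inv (h.mem_B x (Set.mem_univ x))]
    · rw [← hY]
      ext a l
      exact pderiv_neg _ i x
    · have hX : IsPrimitive A B X := ⟨hXs, hXd⟩
      refine ⟨fun j hB => ?_, fun hB => IsPrimitive.isTuple h hA hX hB⟩
      have hfr := IsPrimitive.isParallelNormalFrame hA hX hB
      have hfo := IsPrimitive.hasTupleForms hA hX hB
      refine ⟨IsPrimitive.isImmersionOn hA hX hB, hfr.hasFlatNormalBundle isOpen_univ, hfr,
        IsPrimitive.isHyperbolicCurvatureCoords h.smooth_B h.smooth_G h.mem_B hfo, hfo,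
        fun x => ?_⟩
      have hx := Set.mem_univ x
      exact nondegenerateAt_iff (hB x) (lorentzSign_ne_zero j) (hfr.orthonormal x hx)
        (hfr.span_eq x hx) (hfo.1 x hx) (hfo.2 x hx)
  · have hG0 : ∀ x ∈ O, ∀ i, ∃ k, G x k i ≠ 0 := by
      rcases hnd with hnd | hG0
      · exact fun x hx i => exists_ne_zero_of_nondegenerateAt (hf 0) (hX.immersion 0) (he 0) hx
          (hnd 0 x hx) i
      · exact hG0
    obtain ⟨u, hu⟩ := hX.exists_isPrincipalFrame he hB hG hBO hf hG0
    exact hu.isSystemII
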